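/- Let $\Lambda\subset(0,\pi]$ be a compact set of frequencies (for instance the finite set of Fourier frequencies, or an interval $[2\pi/n,\pi]$). Let $F_0$ be a probability law of $(y,\lambda)\in\mathbb R\times\Lambda$ ($y$ is the log-periodogram response, $\lambda$ the frequency) that has conditional densities $f_0(y|\lambda)$ of $y$ given $\lambda$: $f_0(\cdot|\lambda)$ is a probability density for every $\lambda\in\Lambda$ and $F_0(dy,d\lambda)=f_0(y|\lambda)\,dy\,Q(d\lambda)$, with $Q$ the marginal law of $\lambda$. Let $c_0,d_0\in\mathbb R$ and assume: 1. $\mathbb E[y|\lambda]=c_0-d_0\log\lambda$ almost surely; 2. $f_0$ is continuous on $\mathbb R\times\Lambda$ at $F_0$-almost every $(y,\lambda)$; 3. for all $\mu\in\mathbb R$ and $\sigma>0$, $\log N(y;\mu,\sigma^2)$ is $F_0$-integrable, where $N(\cdot\,;\mu,\sigma^2)$ is the Gaussian density; 4. $\mathbb E[y^2|\lambda]<\infty$ for all $\lambda\in\Lambda$; 5. there is $\delta>0$ with $$\int\log\frac{f_0(y|\lambda)}{\inf\{f_0(s|t):\ s\in\mathbb R,\ t\in\Lambda,\ |y-s|<\delta,\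 |\lambda-t|<\delta\}}\,F_0(dy,d\lambda)<\infty .$$ Consider the model $$f(y|\lambda,c,d,\eta)=\sum_{h=1}^\infty p_h(\lambda)\,b(y-c+d\log\lambda;\pi_h,\mu_h,\sigma_{1h},\sigma_{2h}),$$ $$b(u;\pi,\mu,\sigma_1,\sigma_2)=\pi N(u;\mu,\sigma_1^2)+(1-\pi)N\Big(u;-\mu\tfrac{\pi}{1-\pi},\sigma_2^2\Big),$$ $$p_h(\lambda)=V_h\,w(\lambda,\psi_h)\prod_{\ell<h}\big(1-V_\ell\,w(\lambda,\psi_\ell)\big),\qquad w(\lambda,\psi)=\exp\!\big(-(\lambda-\psi)^2/\xi^2\big),$$ with parameter $(c,d,\eta)$, $\eta=(\xi,(V_h,\pi_h,\mu_h,\sigma_{1h},\sigma_{2h},\psi_h)_{h\ge1})$. Let $\Pi$ be a prior under which $c\sim\Pi_c$, $d\sim\Pi_d$, $\xi\sim\Xi$, $V_h\sim\mathrm{Be}(a_h,b_h)$ with $a_h,b_h>0$, $(\pi_h,\mu_h,\sigma_{1h},\sigma_{2h})\sim G$ and $\psi_h\sim\Psi$, $h\ge1$, are all independent, where $\Pi_c,\Pi_d,\Xi,G,\Psi$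 are probability measures such that - $c_0$ and $d_0$ are interior points of the supports of $\Pi_c$ and $\Pi_d$; - $\Xi$ is carried by $(0,\infty)$ and $\Xi(\xi<\delta)>0$ for every $\delta>0$ (e.g. an inverse gamma law); - $\Psi$ has support $\Lambda$ (e.g. the uniform law on the Fourier frequencies or on the interval); - $G$ is carried by $(0,1)\times\mathbb R\times(0,\infty)^2$, and given the scales $(\pi,\mu)$ has full support: $G\big((\pi,\mu)\in U,(\sigma_1,\sigma_2)\in S\big)>0$ for every nonempty open $U\subset(0,1)\times\mathbb R$ and every Borel $S$ with $G\big((\sigma_1,\sigma_2)\in S\big)>0$ (e.g. a normal-inverse gamma law of $(\mu,\sigma_1,\sigma_2)$ and an independent law of $\pi$ with full support in $(0,1)$); - $\Pi(\sigma_{1h}<\delta)>0$ for every $\delta>0$. Then $f_0$ lies in the Kullback–Leibler support of $\Pi$: for every $\varepsilon>0$, $$\Pi\Big(\Big\{(c,d,\eta):\ \int\log\frac{f_0(y|\lambda)}{f(y|\lambda,c,d,\eta)}\,F_0(dy,d\lambda)<\varepsilon\Big\}\Big)>0 .$$ -/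

import Mathlib

open MeasureTheory ProbabilityTheory Set
open scoped ENNReal

noncomputable section

namespace LogPeriodogram

/-- The two-component Gaussian mixture
`b(u; π, μ, σ₁, σ₂) = π N(u; μ, σ₁²) + (1 - π) N(u; -μ π / (1 - π), σ₂²)`, which has mean zero
when `0 < π < 1`. -/
def mixKernel (π μ σ₁ σ₂ u : ℝ) : ℝ≥0∞ :=
  ENNReal.ofReal π * gaussianPDF μ (Real.toNNReal (σ₁ ^ 2)) u
    + ENNReal.ofReal (1 - π) * gaussianPDF (-μ * (π / (1 - π))) (Real.toNNReal (σ₂ ^ 2)) u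

/-- The squared exponential kernel with bandwidth `ξ`. -/
def sqExpKernel (ξ l ψ : ℝ) : ℝ := Real.exp (-(l - ψ) ^ 2 / ξ ^ 2)

/-- A mixture atom `(π, μ, σ₁, σ₂)`. -/
abbrev Atom : Type := ℝ × ℝ × ℝ × ℝ

/-- The parameters `(V, (π, μ, σ₁, σ₂), ψ)` attached to one component of the infinite mixture:
the stick variable, the atom and the knot. -/
abbrev Component : Type := ℝ × Atom × ℝ

/-- The full parameter `(c, d, ξ, ((V_h, (π_h, μ_h, σ₁_h, σ₂_h), ψ_h))_h)`; components are
indexed from `0`. -/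
abbrev Param : Type := ℝ × ℝ × ℝ × (ℕ → Component)

/-- `V_h(λ) = V_h w(λ, ψ_h)`. -/
def stick (ξ : ℝ) (η : ℕ → Component) (h : ℕ) (l : ℝ) : ℝ :=
  (η h).1 * sqExpKernel ξ l (η h).2.2

/-- The kernel stick-breaking weights `p_h(λ) = V_h(λ) ∏_{j < h} (1 - V_j(λ))`. -/
def weight (ξ : ℝ) (η : ℕ → Component) (h : ℕ) (l : ℝ) : ℝ :=
  stick ξ η h l * ∏ j ∈ Finset.range h, (1 - stick ξ η j l)

/-- The model density
`f(y | λ, c, d, η) = ∑_h p_h(λ) b(y - c + d log λ; π_h, μ_h, σ₁_h, σ₂_h)`. -/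
def modelDensity (θ : Param) (y l : ℝ) : ℝ≥0∞ :=
  ∑' h : ℕ, ENNReal.ofReal (weight θ.2.2.1 θ.2.2.2 h l) *
    mixKernel (θ.2.2.2 h).2.1.1 (θ.2.2.2 h).2.1.2.1 (θ.2.2.2 h).2.1.2.2.1 (θ.2.2.2 h).2.1.2.2.2
      (y - θ.1 + θ.2.1 * Real.log l)

/-- The kernel stick-breaking prior: `c ∼ Pc`, `d ∼ Pd`, `ξ ∼ Ξ` and, for every `h`,
`V_h ∼ Be(a_h, b_h)`, `(π_h, μ_h, σ₁_h, σ₂_h) ∼ G`, `ψ_h ∼ Ψ`, all independent. -/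
def prior (Pc Pd Ξ : Measure ℝ) (a b : ℕ → ℝ) (G : Measure Atom) (Ψ : Measure ℝ) :
    Measure Param :=
  Pc.prod (Pd.prod (Ξ.prod
    (Measure.infinitePi fun h => (betaMeasure (a h) (b h)).prod (G.prod Ψ))))

/-- `f₀(y | λ)` is a family of densities on `ℝ`, indexed by `λ ∈ Λ`, and is the conditional density
of `y` given `λ` when `(y, λ) ∼ F₀`; the second marginal of `F₀` is carried by `Λ`. -/
structure IsCondDensity (Λ : Set ℝ) (F₀ : Measure (ℝ × ℝ)) (f₀ : ℝ → ℝ → ℝ) : Prop where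
  measurable : Measurable (Function.uncurry f₀)
  nonneg : ∀ y, ∀ l ∈ Λ, 0 ≤ f₀ y l
  lintegral_eq_one : ∀ l ∈ Λ, ∫⁻ y, ENNReal.ofReal (f₀ y l) = 1
  marginal : F₀.snd Λᶜ = 0
  law_eq : F₀ = (volume.prod F₀.snd).withDensity fun p => ENNReal.ofReal (f₀ p.1 p.2)

/-- The infimum of `f₀(s | t)` over `s ∈ ℝ`, `t ∈ Λ` with `|y - s| < δ` and `|λ - t| < δ`. -/
def localInf (Λ : Set ℝ) (f₀ : ℝ → ℝ → ℝ) (δ : ℝ) (p : ℝ × ℝ) : ℝ≥0∞ :=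
  ⨅ q ∈ {q : ℝ × ℝ | q.2 ∈ Λ ∧ |p.1 - q.1| < δ ∧ |p.2 - q.2| < δ}, ENNReal.ofReal (f₀ q.1 q.2)

open Classical in
/-- The Kullback-Leibler divergence `∫ log (f₀(y | λ) / f(y | λ)) F₀(dy, dλ)`: the joint densities
of truth and model share the density of `λ`, which cancels in the ratio. If `f` vanishes or is
infinite on a set of positive `F₀`-measure, or if the integral does not converge absolutely,
the value is `⊤`. (When `f(· | λ)` has total mass at most one the negative part of the logarithm is
always integrable, so that non-integrability means that the integral is `+∞`.) -/
def condKL (F₀ : Measure (ℝ × ℝ)) (f₀ : ℝ → ℝ → ℝ) (f : ℝ → ℝ → ℝ≥0∞) : EReal :=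
  if (∀ᵐ p ∂F₀, f p.1 p.2 ≠ 0 ∧ f p.1 p.2 ≠ ⊤) ∧
      Integrable (fun p : ℝ × ℝ => Real.log (f₀ p.1 p.2 / (f p.1 p.2).toReal)) F₀
  then ((∫ p, Real.log (f₀ p.1 p.2 / (f p.1 p.2).toReal) ∂F₀ : ℝ) : EReal)
  else ⊤

end LogPeriodogram

end

open LogPeriodogram

/-! The divergence is controlled by two lower bounds on the model density `f`: a Gaussian bound `A
exp(-k y²)` valid everywhere, and `τ` times the local infimum of `f₀` at radius `δ'`, valid for `|y|
≤ R`. For fixed `A` and `k`, as `δ' → 0` and `R → ∞`, the resulting majorant of `log (f₀ / f)` tends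
to `-log τ` by continuity of `f₀`, and it is dominated by the log-ratio at the fixed radius `δ` plus
a multiple of `y²` (`exists_dominating_sequence`). It remains to show that the prior charges such
bounds, with `τ` close to one and with `A`, `k` chosen before `δ'` and `R` (`prior_lowerBound_pos`).
Every approximation costs a power of some `r < 1`, and the total is `τ = r ^ 14`.

Take a finite net of knots in `Λ`. At each knot, discretize the law of the centred response into
cells and put a narrow Gaussian at each cell. Such a mixture dominates the local infimum of `f₀`,
because a Gaussian convolution averages values of `f₀` near `y` (`mul_localInf_le_sum_cellMass`).
One further wide Gaussian per knot, of fixed scale and fixed share, supplies the tail bound. For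
small bandwidth the normalized kernels put nearly all their weight on knots near `λ`
(`mul_sum_sqExpKernel_le`).

Stick-breaking weights depend on the order of the sticks and on `λ`, whereas the target weights are
normalized kernels. The remedy is to use many rounds of small sticks, each round running once
through all (knot, cell) pairs. Within a round little mass is used, so each pair receives mass
nearly proportional to its stick; repeating until the stick is almost exhausted normalizes the
weights for all `λ` at once (`le_sum_stick_breaking`, `le_modelDensity_of_rounds`). Only finitely
many components are constrained, each to a box of positive prior mass (`componentBox_pos`,
`prior_pos_of_box`). -/

/-! ### Gaussian densities -/

theorem gaussianPDFReal_toNNReal {v : ℝ} (hv : 0 ≤ v) (μ x : ℝ) :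
    gaussianPDFReal μ v.toNNReal x
      = (√(2 * Real.pi * v))⁻¹ * Real.exp (-(x - μ) ^ 2 / (2 * v)) := by
  rw [gaussianPDFReal, Real.coe_toNNReal v hv]

theorem gaussianPDFReal_comm (μ x : ℝ) (v : NNReal) :
    gaussianPDFReal μ v x = gaussianPDFReal x v μ := by
  simp only [gaussianPDFReal]
  congr 3
  ring

/-- The Gaussian density decreases by at most a factor `r` when the scale grows by at most
`1 / r`. -/
theorem mul_gaussianPDFReal_le_of_scale {r s σ : ℝ} (hr : 0 < r) (hs : 0 < s)
    (h1 : s ≤ σ) (h2 : σ ≤ s / r) (μ u : ℝ) :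
    r * gaussianPDFReal μ (s ^ 2).toNNReal u ≤ gaussianPDFReal μ (σ ^ 2).toNNReal u := by
  have hσ : 0 < σ := hs.trans_le h1
  rw [gaussianPDFReal_toNNReal (sq_nonneg _), gaussianPDFReal_toNNReal (sq_nonneg _), ← mul_assoc]
  have hπ : 0 < √(2 * Real.pi) := by positivity
  have hsqrt : ∀ x : ℝ, 0 < x → √(2 * Real.pi * x ^ 2) = √(2 * Real.pi) * x := fun x hx => by
    rw [Real.sqrt_mul (by positivity), Real.sqrt_sq hx.le]
  rw [hsqrt s hs, hsqrt σ hσ]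
  gcongr ?_ * ?_
  · rw [mul_inv, mul_inv, mul_left_comm]
    gcongr
    rw [← div_eq_mul_inv, ← one_div, div_le_div_iff₀ hs hσ]
    rw [le_div_iff₀ hr] at h2
    linarith
  · apply Real.exp_le_exp.2
    rw [neg_div, neg_div, neg_le_neg_iff]
    gcongr

/-- Convexity of the square with weights `r` and `1 - r`. The factor `1 / r` is what a variance
shrunk by `r` absorbs. -/
theorem sq_sub_le_young {r : ℝ} (hr : 0 < r) (hr1 : r < 1) (u x μ : ℝ) :
    (u - μ) ^ 2 ≤ (u - x) ^ 2 / r + (x - μ) ^ 2 / (1 - r) := by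
  have h1 : 0 < 1 - r := by linarith
  rw [div_add_div _ _ hr.ne' h1.ne', le_div_iff₀ (by positivity)]
  nlinarith [sq_nonneg ((1 - r) * (u - x) - r * (x - μ))]

/-- Shifting the mean by an amount small with respect to the scale and shrinking the variance by
the factor `r` increases a Gaussian density by at most the factor `r ^ (-2)`. -/
theorem mul_gaussianPDFReal_le_of_shift {r v : ℝ} (hr : 0 < r) (hr1 : r < 1) (hv : 0 < v)
    {x μ : ℝ} (h : (x - μ) ^ 2 ≤ 2 * (1 - r) * v * (-Real.log r)) (u : ℝ) :
    r ^ 2 * gaussianPDFReal x (r * v).toNNReal u ≤ gaussianPDFReal μ v.toNNReal u := by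
  rw [gaussianPDFReal_toNNReal (by positivity), gaussianPDFReal_toNNReal hv.le]
  have h1 : 0 < 1 - r := by linarith
  have hexp : r * Real.exp (-(u - x) ^ 2 / (2 * (r * v))) ≤
      Real.exp (-(u - μ) ^ 2 / (2 * v)) := by
    nth_rw 1 [← Real.exp_log hr]
    rw [← Real.exp_add]
    apply Real.exp_le_exp.2
    have hy := sq_sub_le_young hr hr1 u x μ
    have e1 : (x - μ) ^ 2 / (1 - r) ≤ 2 * v * (-Real.log r) := by
      rw [div_le_iff₀ h1]; linarith
    have e2 : (u - x) ^ 2 / (2 * (r * v)) = ((u - x) ^ 2 / r) / (2 * v) := by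
      field_simp
    rw [neg_div, neg_div, e2]
    have e3 : (u - μ) ^ 2 / (2 * v) ≤ ((u - x) ^ 2 / r + 2 * v * (-Real.log r)) / (2 * v) := by
      gcongr; linarith
    rw [add_div, mul_div_cancel_left₀ _ (by positivity : 2 * v ≠ 0)] at e3
    linarith
  have hsq : r * (√(2 * Real.pi * (r * v)))⁻¹ ≤ (√(2 * Real.pi * v))⁻¹ := by
    have e : 2 * Real.pi * (r * v) = r * (2 * Real.pi * v) := by ring
    rw [e, Real.sqrt_mul hr.le, mul_inv, ← mul_assoc]
    apply mul_le_of_le_one_left (by positivity)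
    rw [← div_eq_mul_inv, div_le_one (by positivity)]
    apply Real.le_sqrt_of_sq_le
    nlinarith
  calc r ^ 2 * ((√(2 * Real.pi * (r * v)))⁻¹ * Real.exp (-(u - x) ^ 2 / (2 * (r * v))))
      = (r * (√(2 * Real.pi * (r * v)))⁻¹) * (r * Real.exp (-(u - x) ^ 2 / (2 * (r * v)))) := by
        ring
    _ ≤ _ := by gcongr

/-- Gaussian laws of small variance concentrate near their mean. -/
theorem exists_le_gaussianReal_Ioo {r η : ℝ} (hr : r < 1) (hη : 0 < η) :
    ∃ v₀ : ℝ, 0 < v₀ ∧ ∀ v : ℝ, 0 < v → v < v₀ → ∀ u : ℝ,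
      ENNReal.ofReal r ≤ gaussianReal u v.toNNReal (Ioo (u - η) (u + η)) := by
  -- Chebyshev: the mass outside the window is at most `v / η ^ 2`.
  refine ⟨(1 - r) * η ^ 2, by have : 0 < 1 - r := by linarith
                              positivity, fun v hv hv0 u => ?_⟩
  set P := gaussianReal u v.toNNReal with hP
  have hch := meas_ge_le_variance_div_sq (μ := P) (memLp_id_gaussianReal (μ := u) 2) hη
  have hset : {ω : ℝ | η ≤ |id ω - ∫ x, id x ∂P|} = (Ioo (u - η) (u + η))ᶜ := by
    ext z
    have : ∫ x, id x ∂P = u := by simp [hP]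
    rw [this]
    simp only [id, mem_ofPred_eq, mem_compl_iff, mem_Ioo, ← not_lt, not_iff_not, abs_lt]
    constructor <;> rintro ⟨h1, h2⟩ <;> constructor <;> linarith
  rw [hset, variance_id_gaussianReal, Real.coe_toNNReal v hv.le] at hch
  rw [prob_compl_eq_one_sub measurableSet_Ioo] at hch
  have h2 : ENNReal.ofReal (v / η ^ 2) ≤ ENNReal.ofReal (1 - r) := by
    apply ENNReal.ofReal_le_ofReal
    rw [div_le_iff₀ (by positivity)]
    exact hv0.le
  have h3 := tsub_le_iff_right.1 (hch.trans h2)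
  by_cases hr0 : r ≤ 0
  · simp [ENNReal.ofReal_of_nonpos hr0]
  push Not at hr0
  have h4 : (1 : ℝ≥0∞) = ENNReal.ofReal r + ENNReal.ofReal (1 - r) := by
    rw [← ENNReal.ofReal_add hr0.le (by linarith)]; simp
  rw [h4, add_comm] at h3
  exact (ENNReal.add_le_add_iff_left ENNReal.ofReal_ne_top).1 h3

theorem lintegral_gaussianPDF_le_one (μ : ℝ) (v : NNReal) : ∫⁻ x, gaussianPDF μ v x ≤ 1 := by
  by_cases hv : v = 0
  · simp [hv]
  · exact (lintegral_gaussianPDF_eq_one μ hv).le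

/-! ### Beta laws -/

theorem betaMeasure_Ioo_pos {α β : ℝ} (hα : 0 < α) (hβ : 0 < β) {x y : ℝ} (hx : 0 ≤ x)
    (hxy : x < y) (hy : y ≤ 1) : 0 < betaMeasure α β (Ioo x y) := by
  rw [betaMeasure, withDensity_apply _ measurableSet_Ioo]
  have hm : Measurable (betaPDF α β) := (measurable_betaPDFReal α β).ennreal_ofReal
  rw [lintegral_pos_iff_support hm, Measure.restrict_apply (measurableSet_support hm)]
  have : Function.support (betaPDF α β) ∩ Ioo x y = Ioo x y := by
    refine inter_eq_right.2 fun z hz => ?_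
    exact (ENNReal.ofReal_pos.2
      (betaPDFReal_pos (hx.trans_lt hz.1) (hz.2.trans_le hy) hα hβ)).ne'
  rw [this, Real.volume_Ioo]
  simpa using hxy

theorem betaMeasure_compl_Ioo (α β : ℝ) : betaMeasure α β (Ioo 0 1)ᶜ = 0 := by
  rw [betaMeasure, withDensity_apply _ measurableSet_Ioo.compl]
  refine setLIntegral_eq_zero measurableSet_Ioo.compl fun x hx => ?_
  have h : ¬ (0 < x ∧ x < 1) := hx
  simp [betaPDF_eq, h]

/-! ### Stick breaking -/

theorem sum_stick_breaking (s : ℕ → ℝ) (H : ℕ) :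
    ∑ h ∈ Finset.range H, s h * ∏ j ∈ Finset.range h, (1 - s j)
      = 1 - ∏ j ∈ Finset.range H, (1 - s j) := by
  induction H with
  | zero => simp
  | succ n ih => rw [Finset.sum_range_succ, ih, Finset.prod_range_succ]; ring

theorem one_sub_sum_le_prod_one_sub (s : ℕ → ℝ) (hs : ∀ h, s h ∈ Icc (0 : ℝ) 1) (H : ℕ) :
    1 - ∑ h ∈ Finset.range H, s h ≤ ∏ h ∈ Finset.range H, (1 - s h) := by
  induction H with
  | zero => simp
  | succ n ih =>
    rw [Finset.sum_range_succ, Finset.prod_range_succ]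
    have h1 : ∏ h ∈ Finset.range n, (1 - s h) ≤ 1 :=
      Finset.prod_le_one (fun i _ => by linarith [(hs i).2]) fun i _ => by linarith [(hs i).1]
    nlinarith [(hs n).1, (hs n).2]

/-- By the union bound a round with total stick at most `S` leaves at least the fraction `1 - S`,
whatever the order inside the round. -/
theorem pow_le_prod_one_sub {s : ℕ → ℝ} (hs : ∀ h, s h ∈ Icc (0 : ℝ) 1) {B : ℕ} {S : ℝ}
    (hS1 : S ≤ 1) (M : ℕ) (hS : ∀ m < M, ∑ b : Fin B, s (m * B + b) ≤ S) :
    (1 - S) ^ M ≤ ∏ h ∈ Finset.range (M * B), (1 - s h) := by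
  induction M with
  | zero => simp
  | succ m ih =>
    rw [Nat.succ_mul, Finset.prod_range_add, pow_succ]
    have h0 := ih fun k hk => hS k (by omega)
    have h1 := one_sub_sum_le_prod_one_sub (fun b => s (m * B + b)) (fun b => hs _) B
    have h2 := hS m (by omega)
    rw [Fin.sum_univ_eq_sum_range (fun b => s (m * B + b))] at h2
    have h3 : 0 ≤ ∏ h ∈ Finset.range (m * B), (1 - s h) :=
      Finset.prod_nonneg fun i _ => by linarith [(hs i).2]
    exact mul_le_mul h0 (by linarith) (by linarith) h3

/-- Lower bound for a stick-breaking mixture made of `M` similar rounds of `B` sticks. -/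
theorem le_sum_stick_breaking {s : ℕ → ℝ} (hs : ∀ h, s h ∈ Icc (0 : ℝ) 1) {B : ℕ} {S : ℝ}
    (hS1 : S ≤ 1) {l F : Fin B → ℝ} (hl : ∀ b, 0 ≤ l b) (hF : ∀ b, 0 ≤ F b) {f : ℕ → ℝ} (M : ℕ)
    (hS : ∀ m < M, ∑ b : Fin B, s (m * B + b) ≤ S)
    (hls : ∀ m < M, ∀ b : Fin B, l b ≤ s (m * B + b))
    (hFf : ∀ m < M, ∀ b : Fin B, F b ≤ f (m * B + b)) :
    (∑ m ∈ Finset.range M, (1 - S) ^ (m + 1)) * ∑ b, l b * F b ≤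
      ∑ h ∈ Finset.range (M * B), s h * (∏ j ∈ Finset.range h, (1 - s j)) * f h := by
  induction M with
  | zero => simp
  | succ m ih =>
    rw [Finset.sum_range_succ (fun m => (1 - S) ^ (m + 1)) m, Nat.succ_mul, Finset.sum_range_add,
      add_mul]
    refine add_le_add (ih (fun k hk => hS k (by omega)) (fun k hk => hls k (by omega))
      (fun k hk => hFf k (by omega))) ?_
    rw [← Fin.sum_univ_eq_sum_range
      (fun b => s (m * B + b) * (∏ j ∈ Finset.range (m * B + b), (1 - s j)) * f (m * B + b)),
      Finset.mul_sum]
    refine Finset.sum_le_sum fun b _ => ?_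
    -- The sticks before position `(m, b)` all lie in the first `m + 1` complete rounds, whence the
    -- exponent `m + 1`.
    have hprod : (1 - S) ^ (m + 1) ≤ ∏ j ∈ Finset.range (m * B + b), (1 - s j) := by
      refine (pow_le_prod_one_sub hs hS1 (m + 1) fun k hk => hS k (by omega)).trans ?_
      refine Finset.prod_le_prod_of_subset_of_le_one ?_ ?_ ?_
      · intro i hi
        simp only [Finset.mem_range, Nat.succ_mul] at hi ⊢
        omega
      · exact fun i _ => by linarith [(hs i).2]
      · exact fun i _ _ => by linarith [(hs i).1]
    have hp : 0 ≤ (1 - S) ^ (m + 1) := pow_nonneg (by linarith) _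
    have h1 := hls m (by omega) b
    have h2 := hFf m (by omega) b
    calc (1 - S) ^ (m + 1) * (l b * F b) = l b * (1 - S) ^ (m + 1) * F b := by ring
      _ ≤ _ := mul_le_mul (mul_le_mul h1 hprod hp ((hl b).trans h1)) h2 (hF b)
          (mul_nonneg ((hl b).trans h1) (hp.trans hprod))

theorem mul_sum_pow_one_sub (S : ℝ) (M : ℕ) :
    S * ∑ m ∈ Finset.range M, (1 - S) ^ (m + 1) = (1 - S) * (1 - (1 - S) ^ M) := by
  have := mul_neg_geom_sum (1 - S) M
  simp_rw [pow_succ, ← Finset.sum_mul]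
  linear_combination (1 - S) * this

/-! ### Elementary properties of the model -/

theorem sqExpKernel_pos (ξ l ψ : ℝ) : 0 < sqExpKernel ξ l ψ := Real.exp_pos _

theorem sqExpKernel_le_one (ξ l ψ : ℝ) : sqExpKernel ξ l ψ ≤ 1 := by
  refine Real.exp_le_one_iff.2 ?_
  rw [neg_div]
  exact neg_nonpos.2 (by positivity)

/-- The stick variables and the mixing proportions lie in `(0, 1)`. -/
def AdmissibleComponents (η : ℕ → Component) : Prop :=
  ∀ h, (η h).1 ∈ Ioo (0 : ℝ) 1 ∧ (η h).2.1.1 ∈ Ioo (0 : ℝ) 1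

theorem AdmissibleComponents.stick_mem {η : ℕ → Component} (hη : AdmissibleComponents η)
    (ξ : ℝ) (h : ℕ) (l : ℝ) : stick ξ η h l ∈ Icc (0 : ℝ) 1 :=
  ⟨mul_nonneg (hη h).1.1.le (sqExpKernel_pos _ _ _).le,
    mul_le_one₀ (hη h).1.2.le (sqExpKernel_pos _ _ _).le (sqExpKernel_le_one _ _ _)⟩

theorem AdmissibleComponents.weight_nonneg {η : ℕ → Component} (hη : AdmissibleComponents η)
    (ξ : ℝ) (h : ℕ) (l : ℝ) : 0 ≤ weight ξ η h l :=
  mul_nonneg (hη.stick_mem ξ h l).1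
    (Finset.prod_nonneg fun j _ => sub_nonneg.2 (hη.stick_mem ξ j l).2)

/-- The partial sums telescope. Total mass at most one is enough for the divergence bound, so the
sticks need not exhaust the unit mass. -/
theorem AdmissibleComponents.tsum_weight_le_one {η : ℕ → Component}
    (hη : AdmissibleComponents η) (ξ l : ℝ) : ∑' h, ENNReal.ofReal (weight ξ η h l) ≤ 1 := by
  refine ENNReal.tsum_le_of_sum_range_le fun H => ?_
  rw [← ENNReal.ofReal_sum_of_nonneg fun h _ => hη.weight_nonneg ξ h l]
  refine ENNReal.ofReal_le_one.2 ?_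
  simp only [weight]
  rw [sum_stick_breaking]
  exact sub_le_self _ (Finset.prod_nonneg fun j _ => sub_nonneg.2 (hη.stick_mem ξ j l).2)

theorem measurable_mixKernel (π μ σ₁ σ₂ : ℝ) : Measurable (mixKernel π μ σ₁ σ₂) := by
  unfold mixKernel
  exact ((measurable_gaussianPDF _ _).const_mul _).add ((measurable_gaussianPDF _ _).const_mul _)

theorem lintegral_mixKernel_le_one {π : ℝ} (hπ : π ∈ Ioo (0 : ℝ) 1) (μ σ₁ σ₂ : ℝ) :
    ∫⁻ u, mixKernel π μ σ₁ σ₂ u ≤ 1 := by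
  unfold mixKernel
  rw [lintegral_add_left ((measurable_gaussianPDF _ _).const_mul _),
    lintegral_const_mul _ (measurable_gaussianPDF _ _),
    lintegral_const_mul _ (measurable_gaussianPDF _ _)]
  calc _ ≤ ENNReal.ofReal π * 1 + ENNReal.ofReal (1 - π) * 1 := by
        gcongr <;> exact lintegral_gaussianPDF_le_one _ _
    _ = 1 := by
        rw [mul_one, mul_one, ← ENNReal.ofReal_add hπ.1.le (sub_nonneg.2 hπ.2.le)]
        simp

theorem measurable_weight (ξ : ℝ) (η : ℕ → Component) (h : ℕ) : Measurable (weight ξ η h) := by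
  unfold weight stick sqExpKernel
  fun_prop

theorem measurable_modelDensity (θ : Param) :
    Measurable fun p : ℝ × ℝ => modelDensity θ p.1 p.2 := by
  unfold modelDensity
  refine Measurable.tsum fun h => ?_
  have hu : Measurable fun p : ℝ × ℝ => p.1 - θ.1 + θ.2.1 * Real.log p.2 := by fun_prop
  exact ((measurable_weight _ _ _).comp measurable_snd).ennreal_ofReal.mul
    ((measurable_mixKernel _ _ _ _).comp hu)

theorem lintegral_modelDensity_le_one {θ : Param} (hθ : AdmissibleComponents θ.2.2.2) (l : ℝ) :
    ∫⁻ y, modelDensity θ y l ≤ 1 := by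
  unfold modelDensity
  have hm : ∀ h, Measurable fun y : ℝ => mixKernel (θ.2.2.2 h).2.1.1 (θ.2.2.2 h).2.1.2.1
      (θ.2.2.2 h).2.1.2.2.1 (θ.2.2.2 h).2.1.2.2.2 (y - θ.1 + θ.2.1 * Real.log l) := fun h =>
    (measurable_mixKernel _ _ _ _).comp (by fun_prop)
  rw [lintegral_tsum fun h => ((hm h).const_mul _).aemeasurable]
  refine le_trans (ENNReal.tsum_le_tsum fun h => ?_) (hθ.tsum_weight_le_one θ.2.2.1 l)
  rw [lintegral_const_mul _ (hm h)]
  refine mul_le_of_le_one_right' ?_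
  have := lintegral_add_right_eq_self (μ := volume) (mixKernel (θ.2.2.2 h).2.1.1 (θ.2.2.2 h).2.1.2.1
      (θ.2.2.2 h).2.1.2.2.1 (θ.2.2.2 h).2.1.2.2.2) (-θ.1 + θ.2.1 * Real.log l)
  simp only [← add_assoc, ← sub_eq_add_neg] at this
  rw [this]
  exact lintegral_mixKernel_le_one (hθ h).2 _ _ _

/-! ### Lower bounds for the model density -/

/-- The second Gaussian of each kernel and the tail of the series are discarded, so `σ₂` and the
later components need no control. -/
theorem ofReal_sum_weight_le_modelDensity {θ : Param} (hθ : AdmissibleComponents θ.2.2.2)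
    (H : ℕ) (y l : ℝ) :
    ENNReal.ofReal (∑ h ∈ Finset.range H, weight θ.2.2.1 θ.2.2.2 h l *
      ((θ.2.2.2 h).2.1.1 * gaussianPDFReal (θ.2.2.2 h).2.1.2.1
        ((θ.2.2.2 h).2.1.2.2.1 ^ 2).toNNReal (y - θ.1 + θ.2.1 * Real.log l)))
      ≤ modelDensity θ y l := by
  rw [ENNReal.ofReal_sum_of_nonneg fun h _ => mul_nonneg (hθ.weight_nonneg _ _ _)
    (mul_nonneg (hθ h).2.1.le (gaussianPDFReal_nonneg _ _ _))]
  refine le_trans (Finset.sum_le_sum fun h _ => ?_) (ENNReal.sum_le_tsum (Finset.range H))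
  rw [ENNReal.ofReal_mul (hθ.weight_nonneg _ _ _), ENNReal.ofReal_mul (hθ h).2.1.le]
  exact mul_le_mul_right (le_add_of_nonneg_right zero_le) _

/-- If the components come in `M` similar rounds, indexed by pairs (knot, cell), with stick
variables close to `v q`, then the model density is bounded below by a mixture whose weights are
normalized kernels at the knots. -/
theorem le_modelDensity_of_rounds {α β : Type*} [Fintype α] [Fintype β] {B M : ℕ}
    (e : Fin B ≃ α × β) {θ : Param} (hθ : AdmissibleComponents θ.2.2.2) {r v y l : ℝ}
    (hr : 0 < r) (hv : 0 < v) {w : α → ℝ} (hw : ∀ i, 0 < w i) [Nonempty α] {q F : α → β → ℝ}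
    (hq : ∀ i j, 0 ≤ q i j) (hq1 : ∀ i, ∑ j, q i j ≤ 1) (hF : ∀ i j, 0 ≤ F i j)
    (hV : ∀ m < M, ∀ b : Fin B, (θ.2.2.2 (m * B + b)).1 ∈
      Icc (r * (v * q (e b).1 (e b).2)) (v * q (e b).1 (e b).2))
    (hψ : ∀ m < M, ∀ b : Fin B, sqExpKernel θ.2.2.1 l (θ.2.2.2 (m * B + b)).2.2 ∈
      Icc (r * w (e b).1) (w (e b).1 / r))
    (hN : ∀ m < M, ∀ b : Fin B, F (e b).1 (e b).2 ≤ (θ.2.2.2 (m * B + b)).2.1.1 *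
      gaussianPDFReal (θ.2.2.2 (m * B + b)).2.1.2.1
        ((θ.2.2.2 (m * B + b)).2.1.2.2.1 ^ 2).toNNReal (y - θ.1 + θ.2.1 * Real.log l))
    (hS : v * (∑ i, w i) / r ≤ 1 - r) (hM : (1 - v * (∑ i, w i) / r) ^ M ≤ 1 - r) :
    ENNReal.ofReal (r ^ 5 * ∑ i, w i / (∑ k, w k) * ∑ j, q i j * F i j)
      ≤ modelDensity θ y l := by
  set W := ∑ i, w i with hWdef
  have hW : 0 < W := Finset.sum_pos (fun i _ => hw i) Finset.univ_nonempty
  set S := v * W / r with hSdef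
  have hSpos : 0 < S := by positivity
  refine le_trans (ENNReal.ofReal_le_ofReal ?_) (ofReal_sum_weight_le_modelDensity hθ (M * B) y l)
  have key := le_sum_stick_breaking (s := fun h => stick θ.2.2.1 θ.2.2.2 h l)
    (fun h => hθ.stick_mem _ h l) (B := B) (S := S) (by linarith)
    (l := fun b => r ^ 2 * v * (w (e b).1 * q (e b).1 (e b).2))
    (F := fun b => F (e b).1 (e b).2)
    (fun b => by have := hq (e b).1 (e b).2; have := hw (e b).1; positivity)
    (f := fun h => (θ.2.2.2 h).2.1.1 * gaussianPDFReal (θ.2.2.2 h).2.1.2.1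
        ((θ.2.2.2 h).2.1.2.2.1 ^ 2).toNNReal (y - θ.1 + θ.2.1 * Real.log l))
    (fun b => hF _ _) M ?_ ?_ hN
  · refine le_trans ?_ key
    have hgeom := mul_sum_pow_one_sub S M
    set g := ∑ m ∈ Finset.range M, (1 - S) ^ (m + 1)
    -- The geometric sum is `(1 - S) (1 - (1 - S) ^ M)`: one factor `r` because a round is short,
    -- one because few remains are left after `M` rounds.
    have hg : r * r ≤ S * g := by
      rw [hgeom]
      exact mul_le_mul (by linarith) (by linarith) hr.le (by linarith)
    have hsum : ∑ b : Fin B, r ^ 2 * v * (w (e b).1 * q (e b).1 (e b).2) * F (e b).1 (e b).2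
        = r ^ 2 * v * ∑ i, w i * ∑ j, q i j * F i j := by
      rw [Equiv.sum_comp e (fun p : α × β => r ^ 2 * v * (w p.1 * q p.1 p.2) * F p.1 p.2),
        Fintype.sum_prod_type, Finset.mul_sum]
      refine Finset.sum_congr rfl fun i _ => ?_
      rw [Finset.mul_sum, Finset.mul_sum]
      exact Finset.sum_congr rfl fun j _ => by ring
    rw [hsum]
    set X := ∑ i, w i * ∑ j, q i j * F i j with hX
    have hX0 : 0 ≤ X := Finset.sum_nonneg fun i _ => mul_nonneg (hw i).le
      (Finset.sum_nonneg fun j _ => mul_nonneg (hq i j) (hF i j))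
    have hlhs : ∑ i, w i / W * ∑ j, q i j * F i j = X / W := by
      rw [hX, Finset.sum_div]
      exact Finset.sum_congr rfl fun i _ => by ring
    rw [hlhs]
    have hg' : r * r ≤ v * W / r * g := hg
    calc r ^ 5 * (X / W) = (r * r) * (r ^ 3 * (X / W)) := by ring
      _ ≤ (v * W / r * g) * (r ^ 3 * (X / W)) := by gcongr
      _ = g * (r ^ 2 * v * X) := by field_simp
  · intro m hm
    have : ∀ b : Fin B, stick θ.2.2.1 θ.2.2.2 (m * B + b) l ≤
        v / r * (w (e b).1 * q (e b).1 (e b).2) := fun b => by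
      have h1 := (hV m hm b).2
      have h2 := (hψ m hm b).2
      calc stick θ.2.2.1 θ.2.2.2 (m * B + b) l
          ≤ (v * q (e b).1 (e b).2) * (w (e b).1 / r) :=
            mul_le_mul h1 h2 (sqExpKernel_pos _ _ _).le (mul_nonneg hv.le (hq _ _))
        _ = _ := by ring
    refine (Finset.sum_le_sum fun b _ => this b).trans ?_
    rw [Equiv.sum_comp e (fun p : α × β => v / r * (w p.1 * q p.1 p.2)), Fintype.sum_prod_type,
      hSdef, hWdef, mul_div_right_comm, Finset.mul_sum]
    refine Finset.sum_le_sum fun i _ => ?_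
    dsimp only
    rw [← Finset.mul_sum, ← Finset.mul_sum]
    have := hw i
    exact mul_le_mul_of_nonneg_left (mul_le_of_le_one_right this.le (hq1 i)) (by positivity)
  · intro m hm b
    have h1 := (hV m hm b).1
    have h2 := (hψ m hm b).1
    have := hq (e b).1 (e b).2
    have := hw (e b).1
    calc r ^ 2 * v * (w (e b).1 * q (e b).1 (e b).2)
        = (r * (v * q (e b).1 (e b).2)) * (r * w (e b).1) := by ring
      _ ≤ _ := mul_le_mul h1 h2 (by positivity) (hθ _).1.1.le

/-! ### Positivity of the prior on boxes -/

/-- A box of component parameters: stick variable slightly below `V`, mixing proportion close to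
one, first location close to `x`, first scale slightly above `s` and knot close to `τ`. -/
def componentBox (r V x Δ s τ ρ : ℝ) : Set Component :=
  Ioo (r * V) V ×ˢ ({t : Atom | (t.1 ∈ Ioo r 1 ∧ |t.2.1 - x| < Δ) ∧ t.2.2.1 ∈ Icc s (s / r)} ×ˢ
    Metric.ball τ ρ)

theorem measurableSet_componentBox (r V x Δ s τ ρ : ℝ) :
    MeasurableSet (componentBox r V x Δ s τ ρ) := by
  refine measurableSet_Ioo.prod (MeasurableSet.prod ?_ measurableSet_ball)
  refine MeasurableSet.inter (MeasurableSet.inter ?_ ?_) ?_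
  · exact measurable_fst measurableSet_Ioo
  · exact measurableSet_lt (f := fun t : Atom => |t.2.1 - x|) (by fun_prop) measurable_const
  · exact (measurable_fst.comp (measurable_snd.comp measurable_snd)) measurableSet_Icc

/-- The scale window has positive mass under `G`; the full-support assumption then allows `(π, μ)`
to be restricted without losing positivity. -/
theorem componentBox_pos {a b : ℝ} (ha : 0 < a) (hb : 0 < b) {Ψ : Measure ℝ}
    [IsProbabilityMeasure Ψ] {G : Measure Atom} [IsProbabilityMeasure G]
    (hGfull : ∀ U : Set (ℝ × ℝ), IsOpen U → U.Nonempty → U ⊆ Set.Ioo (0 : ℝ) 1 ×ˢ Set.univ →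
      ∀ S : Set (ℝ × ℝ), MeasurableSet S → 0 < G {t | t.2.2 ∈ S} →
        0 < G {t | (t.1, t.2.1) ∈ U ∧ t.2.2 ∈ S})
    {r V x Δ s τ ρ : ℝ} (hr : 0 < r) (hr1 : r < 1) (hV : 0 < V) (hV1 : V ≤ 1) (hΔ : 0 < Δ)
    (hs : 0 < G {t | t.2.2.1 ∈ Icc s (s / r)}) (hτ : τ ∈ Ψ.support) (hρ : 0 < ρ) :
    0 < (betaMeasure a b).prod (G.prod Ψ) (componentBox r V x Δ s τ ρ) := by
  rw [componentBox, Measure.prod_prod, Measure.prod_prod]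
  refine ENNReal.mul_pos (betaMeasure_Ioo_pos ha hb (by positivity) (by nlinarith) hV1).ne'
    (ENNReal.mul_pos ?_ ?_).ne'
  · have := hGfull (Ioo r 1 ×ˢ {μ | |μ - x| < Δ})
      (isOpen_Ioo.prod (isOpen_lt (by fun_prop) continuous_const))
      ((nonempty_Ioo.2 hr1).prod ⟨x, by simpa using hΔ⟩)
      (prod_mono (Ioo_subset_Ioo_left hr.le) (subset_univ _))
      {p | p.1 ∈ Icc s (s / r)} (measurable_fst measurableSet_Icc) hs
    exact this.ne'
  · exact ((Measure.mem_support_iff_forall τ).1 hτ _ (Metric.ball_mem_nhds τ hρ)).ne'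

/-- Only the first `H` components are constrained, so the infinite product reduces to a finite
product of positive masses; admissibility is almost sure. -/
theorem prior_pos_of_box {Pc Pd Ξ : Measure ℝ} [IsProbabilityMeasure Pc] [IsProbabilityMeasure Pd]
    [IsProbabilityMeasure Ξ] {a b : ℕ → ℝ} (ha : ∀ h, 0 < a h) (hb : ∀ h, 0 < b h)
    {Ψ : Measure ℝ} [IsProbabilityMeasure Ψ] {G : Measure Atom} [IsProbabilityMeasure G]
    (hG : ∀ᵐ t ∂G, t.1 ∈ Set.Ioo (0 : ℝ) 1 ∧ 0 < t.2.2.1 ∧ 0 < t.2.2.2)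
    {C D X : Set ℝ} (hC : 0 < Pc C) (hD : 0 < Pd D) (hX : 0 < Ξ X) {K : ℕ → Set Component}
    {H : ℕ} (hKm : ∀ h < H, MeasurableSet (K h))
    (hK : ∀ h < H, 0 < (betaMeasure (a h) (b h)).prod (G.prod Ψ) (K h)) :
    0 < prior Pc Pd Ξ a b G Ψ {θ | θ.1 ∈ C ∧ θ.2.1 ∈ D ∧ θ.2.2.1 ∈ X ∧
      (∀ h < H, θ.2.2.2 h ∈ K h) ∧ AdmissibleComponents θ.2.2.2} := by
  have : ∀ h, IsProbabilityMeasure (betaMeasure (a h) (b h)) := fun h =>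
    isProbabilityMeasureBeta (ha h) (hb h)
  set P := Measure.infinitePi fun h => (betaMeasure (a h) (b h)).prod (G.prod Ψ) with hP
  have hadm : ∀ᵐ η ∂P, AdmissibleComponents η := by
    refine ae_all_iff.2 fun h => ?_
    have hcomp : ∀ᵐ k ∂(betaMeasure (a h) (b h)).prod (G.prod Ψ),
        k.1 ∈ Ioo (0 : ℝ) 1 ∧ k.2.1.1 ∈ Ioo (0 : ℝ) 1 := by
      refine Filter.Eventually.and ?_ ?_
      · exact Measure.quasiMeasurePreserving_fst.ae
          (p := fun x : ℝ => x ∈ Ioo (0 : ℝ) 1) (betaMeasure_compl_Ioo (a h) (b h))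
      · have h1 : ∀ᵐ p ∂G.prod Ψ, p.1.1 ∈ Ioo (0 : ℝ) 1 :=
          Measure.quasiMeasurePreserving_fst.ae (p := fun t : Atom => t.1 ∈ Ioo (0 : ℝ) 1)
            (hG.mono fun t ht => ht.1)
        exact Measure.quasiMeasurePreserving_snd.ae
          (p := fun p : Atom × ℝ => p.1.1 ∈ Ioo (0 : ℝ) 1) h1
    exact (measurePreserving_eval_infinitePi
      (fun h => (betaMeasure (a h) (b h)).prod (G.prod Ψ)) h).quasiMeasurePreserving.ae hcomp
  have hbox : 0 < P ((Set.pi (Finset.range H) K) ∩ {η | AdmissibleComponents η}) := by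
    rw [measure_inter_conull hadm, hP,
      Measure.infinitePi_pi _ (fun h hh => hKm h (by simpa using hh))]
    exact pos_iff_ne_zero.2 (Finset.prod_ne_zero_iff.2 fun h hh =>
      (hK h (Finset.mem_range.1 hh)).ne')
  have hset : {θ : Param | θ.1 ∈ C ∧ θ.2.1 ∈ D ∧ θ.2.2.1 ∈ X ∧
      (∀ h < H, θ.2.2.2 h ∈ K h) ∧ AdmissibleComponents θ.2.2.2}
      = C ×ˢ (D ×ˢ (X ×ˢ ((Set.pi (Finset.range H) K) ∩ {η | AdmissibleComponents η}))) := by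
    ext θ
    simp [Set.mem_pi]
  rw [hset, prior, Measure.prod_prod, Measure.prod_prod, Measure.prod_prod]
  exact ENNReal.mul_pos hC.ne' (ENNReal.mul_pos hD.ne' (ENNReal.mul_pos hX.ne' hbox.ne').ne').ne'

/-- The geometric intervals `[δ r ^ (n + 1), δ r ^ n]` cover `(0, δ)`, so they cannot all be null.
This pins the scale up to a factor `1 / r` without a density for `σ₁`. -/
theorem exists_scale_pos {G : Measure Atom}
    (hG : ∀ᵐ t ∂G, t.1 ∈ Set.Ioo (0 : ℝ) 1 ∧ 0 < t.2.2.1 ∧ 0 < t.2.2.2)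
    (hGσ : ∀ δ : ℝ, 0 < δ → 0 < G {t | t.2.2.1 < δ}) {r : ℝ} (hr : 0 < r) (hr1 : r < 1)
    {δ : ℝ} (hδ : 0 < δ) :
    ∃ s : ℝ, 0 < s ∧ s < δ ∧ 0 < G {t | t.2.2.1 ∈ Icc s (s / r)} := by
  by_contra! hcon
  have hnull : ∀ n : ℕ, G {t | t.2.2.1 ∈ Icc (δ * r ^ (n + 1)) (δ * r ^ (n + 1) / r)} = 0 :=
    fun n => by
      refine le_antisymm (hcon _ (by positivity) ?_) zero_le
      exact mul_lt_of_lt_one_right hδ (pow_lt_one₀ hr.le hr1 (by omega))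
  refine (hGσ δ hδ).ne' ?_
  refine measure_mono_null_ae ?_ (measure_iUnion_null hnull)
  filter_upwards [hG] with t ht hlt
  have hlt' : t.2.2.1 < δ := hlt
  obtain ⟨n, h1, h2⟩ := exists_nat_pow_near_of_lt_one (x := t.2.2.1 / δ) (div_pos ht.2.1 hδ)
    ((div_le_one hδ).2 hlt'.le) hr hr1
  refine mem_iUnion.2 ⟨n, ?_, ?_⟩
  · rw [lt_div_iff₀ hδ] at h1
    linarith
  · rw [div_le_iff₀ hδ] at h2
    rw [pow_succ, ← mul_assoc, mul_div_assoc, div_self hr.ne', mul_one]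
    linarith

/-- Countable exhaustion of `(0, ξ₀)`. A bandwidth bounded away from zero makes the knot tolerance
and the number of rounds uniform. -/
theorem exists_bandwidth_pos {Ξ : Measure ℝ} (hΞ : ∀ᵐ ξ ∂Ξ, 0 < ξ)
    (hΞ0 : ∀ δ : ℝ, 0 < δ → 0 < Ξ (Set.Iio δ)) {ξ₀ : ℝ} (hξ₀ : 0 < ξ₀) :
    ∃ ξ₁ : ℝ, 0 < ξ₁ ∧ 0 < Ξ (Ioo ξ₁ ξ₀) := by
  by_contra! hcon
  refine (hΞ0 ξ₀ hξ₀).ne' ?_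
  refine measure_mono_null_ae ?_ (measure_iUnion_null fun n : ℕ =>
    le_antisymm (hcon (1 / ((n : ℝ) + 1)) (by positivity)) zero_le)
  filter_upwards [hΞ] with ξ h0 h1
  obtain ⟨n, hn⟩ := exists_nat_one_div_lt h0
  exact mem_iUnion.2 ⟨n, hn, h1⟩

/-! ### Localization of the kernels -/

/-- For small bandwidth the normalized kernels concentrate on the knots near `l`. -/
theorem mul_sum_sqExpKernel_le {α : Type*} [Fintype α] {t : α → ℝ} {δ l ξ r : ℝ} (hδ : 0 < δ)
    (hl : ∃ i, |l - t i| < δ / 2)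
    (hξ : Fintype.card α * Real.exp (-(3 / 4 * δ ^ 2) / ξ ^ 2) ≤ 1 - r) :
    r * ∑ i, sqExpKernel ξ l (t i) ≤ ∑ i with |l - t i| < δ, sqExpKernel ξ l (t i) := by
  obtain ⟨k, hk⟩ := hl
  have hsplit := Finset.sum_filter_add_sum_filter_not Finset.univ (fun i => |l - t i| < δ)
    fun i => sqExpKernel ξ l (t i)
  have hkle : sqExpKernel ξ l (t k) ≤ ∑ i, sqExpKernel ξ l (t i) :=
    Finset.single_le_sum (f := fun i => sqExpKernel ξ l (t i))
      (fun i _ => (sqExpKernel_pos ξ l (t i)).le) (Finset.mem_univ k)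
  have hfar : ∑ i with ¬ |l - t i| < δ, sqExpKernel ξ l (t i) ≤
      (1 - r) * sqExpKernel ξ l (t k) := by
    -- A far knot is at distance at least `δ` and the knot `k` within `δ / 2`; the exponents differ
    -- by `δ² - δ² / 4 = 3 / 4 * δ²`.
    have hterm : ∀ i ∈ Finset.univ.filter (fun i => ¬ |l - t i| < δ),
        sqExpKernel ξ l (t i) ≤ Real.exp (-(3 / 4 * δ ^ 2) / ξ ^ 2) * sqExpKernel ξ l (t k) := by
      intro i hi
      have hi' : δ ≤ |l - t i| := not_lt.1 (Finset.mem_filter.1 hi).2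
      rw [sqExpKernel, sqExpKernel, ← Real.exp_add, Real.exp_le_exp, ← add_div]
      gcongr
      have h1 : δ ^ 2 ≤ (l - t i) ^ 2 := by rw [← sq_abs (l - t i)]; gcongr
      have h2 : (l - t k) ^ 2 ≤ (δ / 2) ^ 2 := by
        rw [← sq_abs (l - t k)]; gcongr
      linarith
    refine (Finset.sum_le_card_nsmul _ _ _ hterm).trans ?_
    rw [nsmul_eq_mul, ← mul_assoc]
    refine mul_le_mul_of_nonneg_right (le_trans ?_ hξ) (sqExpKernel_pos _ _ _).le
    gcongr
    exact Finset.card_le_univ _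
  have hr1 : 0 ≤ 1 - r := le_trans (by positivity) hξ
  nlinarith

/-- The kernel is stable under small perturbations of the knot. -/
theorem sqExpKernel_mem_Icc {r ξ₁ ξ ρ l t ψ : ℝ} (hr : 0 < r) (hξ₁ : 0 < ξ₁) (hξ : ξ₁ < ξ)
    (hρ1 : ρ ≤ 1) (hρ : 9 * ρ ≤ ξ₁ ^ 2 * (-Real.log r)) (hψ : |ψ - t| < ρ) (hl : |l - t| ≤ 4) :
    sqExpKernel ξ l ψ ∈ Icc (r * sqExpKernel ξ l t) (sqExpKernel ξ l t / r) := by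
  have hξ2 : 0 < ξ ^ 2 := by have := hξ₁.trans hξ; positivity
  have hdiff : |(l - ψ) ^ 2 - (l - t) ^ 2| ≤ ξ ^ 2 * (-Real.log r) := by
    have e : (l - ψ) ^ 2 - (l - t) ^ 2 = (ψ - t) * ((ψ - t) - 2 * (l - t)) := by ring
    have h0 : 0 < ρ := (abs_nonneg _).trans_lt hψ
    -- `9 = 1 + 2 * 4`, from `ρ ≤ 1` and `|l - t| ≤ 4`.
    have h1 : |(ψ - t) - 2 * (l - t)| ≤ 9 := by
      refine (abs_sub _ _).trans ?_
      rw [abs_mul, abs_two]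
      linarith
    have hlog : 0 ≤ -Real.log r := by
      by_contra! hneg
      have := mul_neg_of_pos_of_neg (pow_pos hξ₁ 2) hneg
      linarith
    rw [e, abs_mul]
    calc |ψ - t| * |(ψ - t) - 2 * (l - t)| ≤ ρ * 9 := by gcongr
      _ ≤ ξ₁ ^ 2 * (-Real.log r) := by linarith
      _ ≤ _ := by gcongr
  rw [abs_le] at hdiff
  have e1 : -(l - t) ^ 2 / ξ ^ 2 + Real.log r ≤ -(l - ψ) ^ 2 / ξ ^ 2 := by
    rw [div_add' _ _ _ hξ2.ne']
    gcongr
    linarith [hdiff.2]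
  have e2 : -(l - ψ) ^ 2 / ξ ^ 2 ≤ -(l - t) ^ 2 / ξ ^ 2 - Real.log r := by
    rw [div_sub' hξ2.ne']
    gcongr
    linarith [hdiff.1]
  constructor
  · unfold sqExpKernel
    nth_rw 1 [← Real.exp_log hr]
    rw [← Real.exp_add]
    exact Real.exp_le_exp.2 (by linarith)
  · unfold sqExpKernel
    refine (Real.exp_le_exp.2 e2).trans_eq ?_
    rw [Real.exp_sub, Real.exp_log hr]

/-! ### Discretization of a density -/

/-- The mass of the `j`-th cell of mesh `Δ` under the density `g`. -/
noncomputable def cellMass (g : ℝ → ℝ≥0∞) (Δ : ℝ) (j : ℤ) : ℝ :=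
  ((volume.withDensity g) {z | ⌊z / Δ⌋ = j}).toReal

theorem cellMass_nonneg (g : ℝ → ℝ≥0∞) (Δ : ℝ) (j : ℤ) : 0 ≤ cellMass g Δ j :=
  ENNReal.toReal_nonneg

theorem measurableSet_cell (Δ : ℝ) (j : ℤ) : MeasurableSet {z : ℝ | ⌊z / Δ⌋ = j} :=
  (Int.measurable_floor.comp (measurable_id.div_const Δ)) (measurableSet_singleton j)

theorem sum_cellMass_le_one {g : ℝ → ℝ≥0∞} (hg : ∫⁻ z, g z = 1) (Δ : ℝ) (N : Finset ℤ) :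
    ∑ j : N, cellMass g Δ j ≤ 1 := by
  have : IsProbabilityMeasure (volume.withDensity g) := 
    ⟨by rw [withDensity_apply _ .univ, Measure.restrict_univ, hg]⟩
  rw [Finset.sum_coe_sort N (fun j => cellMass g Δ j)]
  have : ∑ j ∈ N, cellMass g Δ j = (volume.withDensity g).real (⋃ j ∈ N, {z | ⌊z / Δ⌋ = j}) := by
    rw [measureReal_biUnion_finset]
    · rfl
    · intro i _ j _ hij
      refine Set.disjoint_left.2 fun z hz hz' => hij ?_
      have h1 : ⌊z / Δ⌋ = i := hz
      have h2 : ⌊z / Δ⌋ = j := hz'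
      exact h1.symm.trans h2
    · exact fun j _ => measurableSet_cell Δ j
  rw [this]
  exact measureReal_le_one

/-- A discretized Gaussian convolution of a density dominates the local infimum of the density. -/
theorem mul_localInf_le_sum_cellMass {g : ℝ → ℝ≥0∞} (hg : ∫⁻ z, g z = 1)
    {r v Δ η u I : ℝ} (hr : 0 < r) (hr1 : r < 1) (hv : 0 < v) (hΔ : 0 < Δ)
    (hΔv : Δ ^ 2 ≤ 2 * (1 - r) * v * (-Real.log r)) {N : Finset ℤ} (hI : 0 ≤ I)
    (hw : ENNReal.ofReal r ≤ gaussianReal u (r * v).toNNReal (Ioo (u - η) (u + η)))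
    (hgI : ∀ z ∈ Ioo (u - η) (u + η), ENNReal.ofReal I ≤ g z)
    (hN : ∀ z ∈ Ioo (u - η) (u + η), ⌊z / Δ⌋ ∈ N) :
    r ^ 3 * I ≤ ∑ j : N, cellMass g Δ j * gaussianPDFReal ((j : ℤ) * Δ) v.toNNReal u := by
  have : IsProbabilityMeasure (volume.withDensity g) := 
    ⟨by rw [withDensity_apply _ .univ, Measure.restrict_univ, hg]⟩
  set W := Ioo (u - η) (u + η) with hW
  set P := gaussianReal u (r * v).toNNReal with hP
  have hrv : (r * v).toNNReal ≠ 0 := by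
    simpa [Real.toNNReal_eq_zero] using mul_pos hr hv
  -- Points `z` of the cell are within `Δ` of `jΔ`, so the Gaussian at `jΔ` with variance `v`
  -- dominates `r ^ 2` times the one at `z` with variance `r v`. Symmetry in location and argument
  -- turns the latter into a density in `z` centred at `u`.
  have hcell : ∀ j : ℤ, ENNReal.ofReal (r ^ 2 * I) * P ({z | ⌊z / Δ⌋ = j} ∩ W) ≤
      ENNReal.ofReal (cellMass g Δ j * gaussianPDFReal ((j : ℤ) * Δ) v.toNNReal u) := by
    intro j
    have hm : MeasurableSet ({z | ⌊z / Δ⌋ = j} ∩ W) := (measurableSet_cell Δ j).inter measurableSet_Ioo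
    rw [hP, gaussianReal_apply _ hrv, ← lintegral_const_mul _ (measurable_gaussianPDF _ _)]
    rw [ENNReal.ofReal_mul (cellMass_nonneg g Δ j), cellMass,
      ENNReal.ofReal_toReal (measure_ne_top _ _)]
    refine le_trans (setLIntegral_mono' hm fun z hz => ?_)
      (le_trans (lintegral_mul_const' (μ := volume.restrict ({z | ⌊z / Δ⌋ = j} ∩ W))
        (ENNReal.ofReal (gaussianPDFReal ((j : ℤ) * Δ) v.toNNReal u)) g ENNReal.ofReal_ne_top).le ?_)
    · rw [gaussianPDF, mul_comm (r ^ 2), ENNReal.ofReal_mul hI, mul_assoc,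
        ← ENNReal.ofReal_mul (by positivity), gaussianPDFReal_comm]
      refine mul_le_mul' (hgI z hz.2) (ENNReal.ofReal_le_ofReal ?_)
      refine mul_gaussianPDFReal_le_of_shift hr hr1 hv (le_trans ?_ hΔv) u
      have hzj : ⌊z / Δ⌋ = j := hz.1
      have h1 := Int.floor_le (z / Δ)
      have h2 := Int.lt_floor_add_one (z / Δ)
      rw [hzj] at h1 h2
      rw [le_div_iff₀ hΔ] at h1
      rw [div_lt_iff₀ hΔ] at h2
      nlinarith
    · gcongr
      rw [← withDensity_apply _ hm]
      exact measure_mono inter_subset_left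
  have hsum : ENNReal.ofReal (r ^ 3 * I) ≤ ENNReal.ofReal
      (∑ j : N, cellMass g Δ j * gaussianPDFReal ((j : ℤ) * Δ) v.toNNReal u) := by
    rw [Finset.sum_coe_sort N (fun j => cellMass g Δ j * gaussianPDFReal ((j : ℤ) * Δ) v.toNNReal u),
      ENNReal.ofReal_sum_of_nonneg fun j _ => mul_nonneg (cellMass_nonneg g Δ _)
        (gaussianPDFReal_nonneg _ _ _)]
    have hcover : W ⊆ ⋃ j ∈ N, ({z | ⌊z / Δ⌋ = j} ∩ W) := fun z hz =>
      mem_iUnion₂.2 ⟨⌊z / Δ⌋, hN z hz, rfl, hz⟩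
    calc ENNReal.ofReal (r ^ 3 * I) = ENNReal.ofReal (r ^ 2 * I) * ENNReal.ofReal r := by
          rw [← ENNReal.ofReal_mul (by positivity)]; congr 1; ring
      _ ≤ ENNReal.ofReal (r ^ 2 * I) * ∑ j ∈ N, P ({z | ⌊z / Δ⌋ = j} ∩ W) := by
          gcongr
          exact hw.trans ((measure_mono hcover).trans (measure_biUnion_finset_le _ _))
      _ ≤ _ := by
          rw [Finset.mul_sum]
          exact Finset.sum_le_sum fun j _ => hcell j
  refine (ENNReal.ofReal_le_ofReal_iff ?_).1 hsum
  exact Finset.sum_nonneg fun j _ => mul_nonneg (cellMass_nonneg g Δ _) (gaussianPDFReal_nonneg _ _ _)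

/-- A uniform lower bound for a Gaussian density with bounded location and nearly fixed scale. -/
theorem exp_le_gaussianPDFReal {r s σ C μ u y : ℝ} (hr : 0 < r) (hs : 0 < s)
    (h1 : s ≤ σ) (h2 : σ ≤ s / r) (hμ : |μ| ≤ 1) (hu : |u - y| ≤ C) :
    r * ((√(2 * Real.pi * s ^ 2))⁻¹ * Real.exp (-(C + 1) ^ 2 / s ^ 2)) *
      Real.exp (-(1 / s ^ 2) * y ^ 2) ≤ gaussianPDFReal μ (σ ^ 2).toNNReal u := by
  refine le_trans ?_ (mul_gaussianPDFReal_le_of_scale hr hs h1 h2 μ u)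
  rw [mul_assoc]
  refine mul_le_mul_of_nonneg_left ?_ hr.le
  rw [gaussianPDFReal_toNNReal (sq_nonneg _), mul_assoc, ← Real.exp_add]
  gcongr
  have e : -(C + 1) ^ 2 / s ^ 2 + -(1 / s ^ 2) * y ^ 2
      = -(2 * (C + 1) ^ 2 + 2 * y ^ 2) / (2 * s ^ 2) := by field_simp; ring
  rw [e]
  gcongr
  have h3 : |u - y - μ| ≤ C + 1 := (abs_sub _ _).trans (add_le_add hu hμ)
  have h4 : (u - y - μ) ^ 2 ≤ (C + 1) ^ 2 := by rw [← sq_abs (u - y - μ)]; gcongr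
  nlinarith [sq_nonneg ((u - y - μ) - y)]

/-! ### The prior charges parameters with a good lower bound for the model density -/

theorem exists_bandwidth_exp_le (K : ℕ) {a ε : ℝ} (ha : 0 < a) (hε : 0 < ε) :
    ∃ ξ₀ : ℝ, 0 < ξ₀ ∧ ∀ ξ, 0 < ξ → ξ < ξ₀ → K * Real.exp (-a / ξ ^ 2) ≤ ε := by
  -- From `exp (-x) ≤ 1 / x` at `x = a / ξ²`; `K + 1` keeps the quotient meaningful when `K = 0`.
  refine ⟨√(ε * a / (K + 1)), by positivity, fun ξ hξ hlt => ?_⟩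
  rw [Real.lt_sqrt hξ.le, lt_div_iff₀ (by positivity)] at hlt
  have h1 : a / ξ ^ 2 ≤ Real.exp (a / ξ ^ 2) := by linarith [Real.add_one_le_exp (a / ξ ^ 2)]
  rw [neg_div, Real.exp_neg, ← div_eq_mul_inv, div_le_iff₀ (Real.exp_pos _)]
  refine le_trans ?_ (mul_le_mul_of_nonneg_left h1 hε.le)
  rw [← mul_div_assoc, le_div_iff₀ (by positivity)]
  nlinarith [pow_pos hξ 2]

theorem localInf_le {Λ : Set ℝ} {f₀ : ℝ → ℝ → ℝ} {δ : ℝ} {p : ℝ × ℝ} {s t : ℝ} (ht : t ∈ Λ)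
    (hs : |p.1 - s| < δ) (htp : |p.2 - t| < δ) :
    localInf Λ f₀ δ p ≤ ENNReal.ofReal (f₀ s t) :=
  iInf₂_le (f := fun (q : ℝ × ℝ) (_ : q ∈ {q : ℝ × ℝ | q.2 ∈ Λ ∧ |p.1 - q.1| < δ ∧
    |p.2 - q.2| < δ}) => ENNReal.ofReal (f₀ q.1 q.2)) (s, t) ⟨ht, hs, htp⟩

theorem localInf_le_self {Λ : Set ℝ} {f₀ : ℝ → ℝ → ℝ} {δ : ℝ} (hδ : 0 < δ) {p : ℝ × ℝ}
    (hp : p.2 ∈ Λ) : localInf Λ f₀ δ p ≤ ENNReal.ofReal (f₀ p.1 p.2) :=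
  localInf_le hp (by simpa using hδ) (by simpa using hδ)

/-- The stick proportions of the components at a knot: a fixed share for the wide component, and
essentially the cell masses for the others. -/
noncomputable def stickShare (r Δ : ℝ) (N : Finset ℤ) (g : ℝ → ℝ≥0∞) : Option N → ℝ
  | none => (1 - r) / 2
  | some j => r * cellMass g Δ j + (1 - r) / (2 * N.card)

/-- The flat term in the share of a cell keeps it positive even when the cell has no mass; otherwise
the stick box would be empty. -/
theorem stickShare_pos {r Δ : ℝ} (hr : 0 < r) (hr1 : r < 1) (N : Finset ℤ) (g : ℝ → ℝ≥0∞)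
    (j : Option N) : 0 < stickShare r Δ N g j := by
  have h1 : 0 < 1 - r := by linarith
  rcases j with _ | j
  · simp only [stickShare]
    positivity
  · have := cellMass_nonneg g Δ j
    have : 0 < N.card := Finset.card_pos.2 ⟨j, j.2⟩
    simp only [stickShare]
    positivity

theorem sum_stickShare_le_one {r Δ : ℝ} (hr : 0 < r) {N : Finset ℤ} (hN : N.Nonempty)
    {g : ℝ → ℝ≥0∞} (hg : ∫⁻ z, g z = 1) : ∑ j, stickShare r Δ N g j ≤ 1 := by
  rw [Fintype.sum_option]
  simp only [stickShare]
  rw [Finset.sum_add_distrib, ← Finset.mul_sum, Finset.sum_const, Finset.card_univ,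
    Fintype.card_coe, nsmul_eq_mul]
  have hc : (0 : ℝ) < N.card := by exact_mod_cast hN.card_pos
  have e : (N.card : ℝ) * ((1 - r) / (2 * N.card)) = (1 - r) / 2 := by field_simp
  rw [e]
  nlinarith [sum_cellMass_le_one hg Δ N]

/-- Lower bound for the atom density of a component at a knot. -/
noncomputable def atomBound (r Δ v τ u : ℝ) (N : Finset ℤ) : Option N → ℝ
  | none => τ
  | some j => r ^ 4 * gaussianPDFReal ((j : ℤ) * Δ) v.toNNReal u

/-- Location, tolerance and scale of the components at a knot. -/
noncomputable def atomSpec (Δ s₀ s : ℝ) (N : Finset ℤ) : Option N → ℝ × ℝ × ℝ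
  | none => (0, 1, s₀)
  | some j => ((j : ℤ) * Δ, Δ, s)

/-- The factor `r ^ 4` is `r` for the mixing proportion, `r` for the scale, and `r ^ 2` for moving
the location to `jΔ` while the variance drops from `s²` to `r s²`. -/
theorem atomBound_le {r Δ s₀ s C u y : ℝ} {N : Finset ℤ} (hr : 0 < r) (hr1 : r < 1)
    (hs₀ : 0 < s₀) (hs : 0 < s) (hΔ : Δ ^ 2 ≤ 2 * (1 - r) * (r * s ^ 2) * (-Real.log r))
    (hu : |u - y| ≤ C) (j : Option N) {k : Component} {V τ ρ : ℝ}
    (hk : k ∈ componentBox r V (atomSpec Δ s₀ s N j).1 (atomSpec Δ s₀ s N j).2.1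
      (atomSpec Δ s₀ s N j).2.2 τ ρ) :
    atomBound r Δ (r * s ^ 2) (r * (r * ((√(2 * Real.pi * s₀ ^ 2))⁻¹ *
      Real.exp (-(C + 1) ^ 2 / s₀ ^ 2)) * Real.exp (-(1 / s₀ ^ 2) * y ^ 2))) u N j ≤
      k.2.1.1 * gaussianPDFReal k.2.1.2.1 (k.2.1.2.2.1 ^ 2).toNNReal u := by
  obtain ⟨-, ⟨⟨hπ, hμ⟩, hσ⟩, -⟩ := hk
  have h1 : 0 < 1 - r := by linarith
  rcases j with _ | j
  · simp only [atomBound]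
    simp only [atomSpec, sub_zero] at hμ hσ
    exact mul_le_mul hπ.1.le (exp_le_gaussianPDFReal hr hs₀ hσ.1 hσ.2 hμ.le hu) (by positivity)
      (hr.trans hπ.1).le
  · simp only [atomBound]
    simp only [atomSpec] at hμ hσ
    have hlog : 0 < -Real.log r := neg_pos.2 (Real.log_neg hr hr1)
    have hshift : ((j : ℤ) * Δ - k.2.1.2.1) ^ 2 ≤ 2 * (1 - r) * s ^ 2 * (-Real.log r) := by
      have h2 : ((j : ℤ) * Δ - k.2.1.2.1) ^ 2 ≤ Δ ^ 2 := by
        rw [← sq_abs, abs_sub_comm]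
        gcongr
      refine h2.trans (hΔ.trans ?_)
      gcongr
      exact mul_le_of_le_one_left (sq_nonneg s) hr1.le
    have h3 := mul_gaussianPDFReal_le_of_shift hr hr1 (by positivity : 0 < s ^ 2) hshift u
    have h4 := mul_gaussianPDFReal_le_of_scale hr hs hσ.1 hσ.2 k.2.1.2.1 u
    calc r ^ 4 * gaussianPDFReal ((j : ℤ) * Δ) (r * s ^ 2).toNNReal u
        = r * (r * (r ^ 2 * gaussianPDFReal ((j : ℤ) * Δ) (r * s ^ 2).toNNReal u)) := by ring
      _ ≤ r * gaussianPDFReal k.2.1.2.1 (k.2.1.2.2.1 ^ 2).toNNReal u := by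
          gcongr
          exact le_trans (by gcongr) h4
      _ ≤ _ := by
          gcongr
          · exact gaussianPDFReal_nonneg _ _ _
          · exact hπ.1.le

set_option maxHeartbeats 1000000 in
/-- For every `δ` and `R`, with positive prior probability the model density dominates a fixed
Gaussian kernel everywhere, and essentially dominates the local infimum of the true density on
`[-R, R]`. -/
theorem prior_lowerBound_pos
    {Λ : Set ℝ} (hΛc : IsCompact Λ) (hΛ : Λ ⊆ Set.Ioc 0 Real.pi)
    {f₀ : ℝ → ℝ → ℝ} (hf₀ : ∀ l ∈ Λ, ∫⁻ y, ENNReal.ofReal (f₀ y l) = 1) {c₀ d₀ : ℝ}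
    {Pc Pd : Measure ℝ} [IsProbabilityMeasure Pc] [IsProbabilityMeasure Pd]
    (hc₀ : c₀ ∈ Pc.support) (hd₀ : d₀ ∈ Pd.support)
    {Ξ : Measure ℝ} [IsProbabilityMeasure Ξ] (hΞ : ∀ᵐ ξ ∂Ξ, 0 < ξ)
    (hΞ0 : ∀ δ : ℝ, 0 < δ → 0 < Ξ (Set.Iio δ))
    {a b : ℕ → ℝ} (ha : ∀ h, 0 < a h) (hb : ∀ h, 0 < b h)
    {Ψ : Measure ℝ} [IsProbabilityMeasure Ψ] (hΨ : Ψ.support = Λ)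
    {G : Measure Atom} [IsProbabilityMeasure G]
    (hG : ∀ᵐ t ∂G, t.1 ∈ Set.Ioo (0 : ℝ) 1 ∧ 0 < t.2.2.1 ∧ 0 < t.2.2.2)
    (hGfull : ∀ U : Set (ℝ × ℝ), IsOpen U → U.Nonempty → U ⊆ Set.Ioo (0 : ℝ) 1 ×ˢ Set.univ →
      ∀ S : Set (ℝ × ℝ), MeasurableSet S → 0 < G {t | t.2.2 ∈ S} →
        0 < G {t | (t.1, t.2.1) ∈ U ∧ t.2.2 ∈ S})
    (hGσ : ∀ δ : ℝ, 0 < δ → 0 < G {t | t.2.2.1 < δ})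
    {r : ℝ} (hr : 0 < r) (hr1 : r < 1) :
    ∃ A k : ℝ, 0 < A ∧ 0 < k ∧ ∀ δ : ℝ, 0 < δ → ∀ R : ℝ, 0 < prior Pc Pd Ξ a b G Ψ
      {θ | AdmissibleComponents θ.2.2.2 ∧ ∀ l ∈ Λ, ∀ y : ℝ,
        ENNReal.ofReal (A * Real.exp (-k * y ^ 2)) ≤ modelDensity θ y l ∧
        (|y| ≤ R → ENNReal.ofReal (r ^ 14) * localInf Λ f₀ δ (y, l) ≤ modelDensity θ y l)} := by
  have h1r : 0 < 1 - r := by linarith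
  have hlogr : 0 < -Real.log r := neg_pos.2 (Real.log_neg hr hr1)
  have hΛne : Λ.Nonempty := by
    rw [← hΨ]
    exact Measure.nonempty_support (IsProbabilityMeasure.ne_zero Ψ)
  have hlogc : ContinuousOn Real.log Λ :=
    Real.continuousOn_log.mono fun l hl => (hΛ hl).1.ne'
  obtain ⟨L, hL⟩ := hΛc.exists_bound_of_continuousOn hlogc
  have hL0 : 0 ≤ L := (norm_nonneg _).trans (hL _ hΛne.some_mem)
  set m₀ : ℝ → ℝ := fun l => c₀ - d₀ * Real.log l with hm₀
  have hm₀c : UniformContinuousOn m₀ Λ :=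
    hΛc.uniformContinuousOn_of_continuous (continuousOn_const.sub (continuousOn_const.mul hlogc))
  set C : ℝ := |c₀| + 1 + (|d₀| + 1) * L with hC
  -- The wide scale is fixed before `δ` and `R`, so `A` and `k` do not depend on them.
  obtain ⟨s₀, hs₀, -, hs₀G⟩ := exists_scale_pos hG hGσ hr hr1 one_pos
  set A₀ : ℝ := r * ((√(2 * Real.pi * s₀ ^ 2))⁻¹ * Real.exp (-(C + 1) ^ 2 / s₀ ^ 2)) with hA₀
  have hA₀pos : 0 < A₀ := by positivity
  refine ⟨r ^ 6 * ((1 - r) / 2) * A₀, 1 / s₀ ^ 2, by positivity, by positivity, fun δ hδ R => ?_⟩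
  -- Three errors below `η` will add up: perturbation of `(c, d)`, variation of the mean between `l`
  -- and a near knot, and the Gaussian window. Their sum stays below `δ`.
  set η : ℝ := min δ 1 / 4 with hη
  have hηpos : 0 < η := by positivity
  have hηδ : 4 * η ≤ δ := by rw [hη]; linarith [min_le_left δ 1]
  have hη1 : 4 * η ≤ 1 := by rw [hη]; linarith [min_le_right δ 1]
  obtain ⟨δ₁, hδ₁, hm₀δ⟩ := Metric.uniformContinuousOn_iff.1 hm₀c η hηpos
  set δ₂ : ℝ := min δ₁ δ with hδ₂
  have hδ₂pos : 0 < δ₂ := lt_min hδ₁ hδ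
  obtain ⟨T', hT'Λ, hT'fin, hT'cov⟩ := hΛc.finite_cover_balls (half_pos hδ₂pos)
  obtain ⟨T, rfl⟩ : ∃ T : Finset ℝ, (T : Set ℝ) = T' := ⟨hT'fin.toFinset, hT'fin.coe_toFinset⟩
  have hnet : ∀ l ∈ Λ, ∃ i : T, |l - i| < δ₂ / 2 := fun l hl => by
    obtain ⟨i, hi, hli⟩ := mem_iUnion₂.1 (hT'cov hl)
    exact ⟨⟨i, hi⟩, by rwa [Metric.mem_ball, Real.dist_eq] at hli⟩
  have : Nonempty T := ⟨(hnet _ hΛne.some_mem).choose⟩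
  have hTΛ : ∀ i : T, (i : ℝ) ∈ Λ := fun i => hT'Λ i.2
  set n : ℝ := ((Fintype.card T : ℕ) : ℝ) with hn
  have hn1 : 1 ≤ n := by
    rw [hn]
    exact_mod_cast Fintype.card_pos (α := T)
  obtain ⟨ξ₀, hξ₀, hξ₀exp⟩ := exists_bandwidth_exp_le (Fintype.card T)
    (by positivity : 0 < 3 / 4 * δ₂ ^ 2) h1r
  obtain ⟨ξ₁, hξ₁, hξ₁Ξ⟩ := exists_bandwidth_pos hΞ hΞ0 hξ₀
  obtain ⟨v₀, hv₀, hv₀g⟩ := exists_le_gaussianReal_Ioo hr1 hηpos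
  obtain ⟨s, hs, hsv, hsG⟩ := exists_scale_pos hG hGσ hr hr1 (Real.sqrt_pos.2 hv₀)
  have hsv₀ : s ^ 2 < v₀ := (Real.lt_sqrt hs.le).1 hsv
  set Δ : ℝ := √(2 * (1 - r) * (r * s ^ 2) * (-Real.log r)) with hΔ
  have hΔpos : 0 < Δ := by positivity
  have hΔsq : Δ ^ 2 = 2 * (1 - r) * (r * s ^ 2) * (-Real.log r) := Real.sq_sqrt (by positivity)
  -- For `|y| ≤ R` the residual satisfies `|u| ≤ |R| + C`, and the window around it has radius `η ≤
  -- 1`, so its cells are all in `N`.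
  set U : ℝ := |R| + C + 1 with hU
  have hU0 : 0 ≤ U := by positivity
  set N : Finset ℤ := Finset.Icc ⌊-U / Δ⌋ ⌊U / Δ⌋ with hN
  have hNne : N.Nonempty := Finset.nonempty_Icc.2 (Int.floor_mono (by gcongr; linarith))
  set g : T → ℝ → ℝ≥0∞ := fun i z => ENNReal.ofReal (f₀ (z + m₀ i) i) with hg
  have hg1 : ∀ i, ∫⁻ z, g i z = 1 := fun i => by
    rw [hg]
    simp only
    rw [lintegral_add_right_eq_self (fun z => ENNReal.ofReal (f₀ z i)) (m₀ i)]
    exact hf₀ i (hTΛ i)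
  set q : T → Option N → ℝ := fun i => stickShare r Δ N (g i) with hq
  have hqpos : ∀ i j, 0 < q i j := fun i j => stickShare_pos hr hr1 N (g i) j
  have hqsum : ∀ i, ∑ j, q i j ≤ 1 := fun i => sum_stickShare_le_one hr hNne (hg1 i)
  have hq1 : ∀ i j, q i j ≤ 1 := fun i j =>
    (Finset.single_le_sum (fun j _ => (hqpos i j).le) (Finset.mem_univ j)).trans (hqsum i)
  -- Since `W ≤ n`, this gives `v * W / r ≤ 1 - r`: every round is short, uniformly in `l`.
  set v : ℝ := r * (1 - r) / n with hv
  have hvpos : 0 < v := by positivity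
  have hv1 : v ≤ 1 := by
    rw [hv, div_le_one (by positivity)]
    have := mul_le_mul hr1.le (by linarith : 1 - r ≤ 1) h1r.le zero_le_one
    linarith
  -- A lower bound for the kernel sum valid for all `l ∈ Λ` and all `ξ > ξ₁`, so that one number of
  -- rounds `M` serves every frequency.
  set wmin : ℝ := Real.exp (-16 / ξ₁ ^ 2) with hwmin
  obtain ⟨M, hM⟩ := exists_pow_lt_of_lt_one h1r
    (show 1 - v * wmin / r < 1 by have : 0 < v * wmin / r := by positivity
                                  linarith)
  set ρ : ℝ := min 1 (ξ₁ ^ 2 * (-Real.log r) / 9) with hρ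
  have hρpos : 0 < ρ := by positivity
  have hρ1 : ρ ≤ 1 := min_le_left _ _
  have hρ9 : 9 * ρ ≤ ξ₁ ^ 2 * (-Real.log r) := by
    have := min_le_right 1 (ξ₁ ^ 2 * (-Real.log r) / 9)
    rw [← hρ] at this
    linarith
  set B : ℕ := Fintype.card (T × Option N) with hB
  have hBpos : 0 < B := Fintype.card_pos
  set e : Fin B ≃ T × Option N := (Fintype.equivFin _).symm with he
  -- Periodic in `h` with period `B`: each round repeats the same list of (knot, cell) boxes.
  set K : ℕ → Set Component := fun h =>
    let p := e ⟨h % B, Nat.mod_lt _ hBpos⟩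
    componentBox r (v * q p.1 p.2) (atomSpec Δ s₀ s N p.2).1 (atomSpec Δ s₀ s N p.2).2.1
      (atomSpec Δ s₀ s N p.2).2.2 p.1 ρ with hK
  have hKe : ∀ m, ∀ b : Fin B, K (m * B + b) = componentBox r (v * q (e b).1 (e b).2)
      (atomSpec Δ s₀ s N (e b).2).1 (atomSpec Δ s₀ s N (e b).2).2.1
      (atomSpec Δ s₀ s N (e b).2).2.2 (e b).1 ρ := fun m b => by
    have : (⟨(m * B + b) % B, Nat.mod_lt _ hBpos⟩ : Fin B) = b := by
      ext
      simp [Nat.mod_eq_of_lt b.2]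
    simp only [hK, this]
  have hbox := prior_pos_of_box (Pc := Pc) (Pd := Pd) (Ξ := Ξ) ha hb (Ψ := Ψ) hG
    (C := Metric.ball c₀ (η / 2)) (D := Metric.ball d₀ (η / (2 * (L + 1)))) (X := Ioo ξ₁ ξ₀)
    ((Measure.mem_support_iff_forall c₀).1 hc₀ _ (Metric.ball_mem_nhds _ (by positivity)))
    ((Measure.mem_support_iff_forall d₀).1 hd₀ _ (Metric.ball_mem_nhds _ (by positivity)))
    hξ₁Ξ (K := K) (H := M * B) (fun h _ => measurableSet_componentBox _ _ _ _ _ _ _)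
    (fun h _ => by
      refine componentBox_pos (ha h) (hb h) hGfull hr hr1 (mul_pos hvpos (hqpos _ _))
        (mul_le_one₀ hv1 (hqpos _ _).le (hq1 _ _)) ?_ ?_ (hΨ ▸ hTΛ _) hρpos
      · rcases (e ⟨h % B, Nat.mod_lt _ hBpos⟩).2 with _ | j
        · exact one_pos
        · exact hΔpos
      · rcases (e ⟨h % B, Nat.mod_lt _ hBpos⟩).2 with _ | j
        · exact hs₀G
        · exact hsG)
  refine hbox.trans_le (measure_mono ?_)
  rintro θ ⟨hθc, hθd, hθξ, hθK, hadm⟩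
  refine ⟨hadm, fun l hl y => ?_⟩
  rw [Metric.mem_ball, Real.dist_eq] at hθc hθd
  have hcomp : ∀ m < M, ∀ b : Fin B, θ.2.2.2 (m * B + b) ∈
      componentBox r (v * q (e b).1 (e b).2) (atomSpec Δ s₀ s N (e b).2).1
        (atomSpec Δ s₀ s N (e b).2).2.1 (atomSpec Δ s₀ s N (e b).2).2.2 (e b).1 ρ :=
    fun m hm b => by
      rw [← hKe m b]
      refine hθK _ ?_
      have : (m + 1) * B ≤ M * B := Nat.mul_le_mul_right B hm
      have := b.2
      rw [Nat.succ_mul] at *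
      omega
  set u : ℝ := y - θ.1 + θ.2.1 * Real.log l with hu
  have hlogl : |Real.log l| ≤ L := hL l hl
  have hum : |y - u - m₀ l| < η := by
    have e1 : y - u - m₀ l = (θ.1 - c₀) - (θ.2.1 - d₀) * Real.log l := by rw [hu, hm₀]; ring
    have e2 : |(θ.2.1 - d₀) * Real.log l| ≤ η / 2 := by
      rw [abs_mul]
      calc |θ.2.1 - d₀| * |Real.log l| ≤ η / (2 * (L + 1)) * (L + 1) := by
            gcongr
            linarith
        _ = η / 2 := by field_simp
    rw [e1]
    exact (abs_sub _ _).trans_lt (by linarith)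
  have huy : |u - y| ≤ C := by
    have e1 : u - y = -(y - u - m₀ l) - c₀ + d₀ * Real.log l := by rw [hm₀]; ring
    have e2 : |d₀ * Real.log l| ≤ |d₀| * L := by rw [abs_mul]; gcongr
    rw [e1, hC]
    refine (abs_add_le _ _).trans ?_
    have := abs_sub (-(y - u - m₀ l)) c₀
    rw [abs_neg] at this
    linarith
  set w : T → ℝ := fun i => sqExpKernel θ.2.2.1 l i with hw
  have hwpos : ∀ i, 0 < w i := fun i => sqExpKernel_pos _ _ _
  set W : ℝ := ∑ i, w i with hW
  have hWpos : 0 < W := Finset.sum_pos (fun i _ => hwpos i) Finset.univ_nonempty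
  have hlt : ∀ i : T, |l - i| ≤ 4 := fun i => by
    have h1 := hΛ hl
    have h2 := hΛ (hTΛ i)
    have := Real.pi_le_four
    rw [abs_le]
    constructor <;> linarith [h1.1, h1.2, h2.1, h2.2]
  have hWn : W ≤ n := by
    rw [hW, hn, ← Finset.card_univ, ← nsmul_one]
    exact Finset.sum_le_card_nsmul _ _ _ fun i _ => sqExpKernel_le_one _ _ _
  have hWmin : wmin ≤ W := by
    obtain ⟨i⟩ := (inferInstance : Nonempty T)
    refine le_trans ?_ (Finset.single_le_sum (fun i _ => (hwpos i).le) (Finset.mem_univ i))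
    refine Real.exp_le_exp.2 ?_
    rw [neg_div, neg_div, neg_le_neg_iff]
    have h3 : (l - i) ^ 2 ≤ 16 := by
      rw [← sq_abs]
      exact (pow_le_pow_left₀ (abs_nonneg _) (hlt i) 2).trans_eq (by norm_num)
    have h4 : ξ₁ ^ 2 ≤ θ.2.2.1 ^ 2 := pow_le_pow_left₀ hξ₁.le hθξ.1.le 2
    exact div_le_div₀ (by norm_num) h3 (by positivity) h4
  have hS : v * W / r ≤ 1 - r := by
    rw [div_le_iff₀ hr]
    calc v * W ≤ v * n := by gcongr
      _ = (1 - r) * r := by rw [hv]; field_simp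
  set E : ℝ := r * (A₀ * Real.exp (-(1 / s₀ ^ 2) * y ^ 2)) with hE
  have hEpos : 0 < E := by positivity
  set F : T → Option N → ℝ := fun _ => atomBound r Δ (r * s ^ 2) E u N with hF
  have hF0 : ∀ i j, 0 ≤ F i j := fun i j => by
    rcases j with _ | j
    · exact hEpos.le
    · exact mul_nonneg (by positivity) (gaussianPDFReal_nonneg _ _ _)
  have hmodel := le_modelDensity_of_rounds e hadm (y := y) (l := l) hr hvpos hwpos (q := q) (F := F)
    (fun i j => (hqpos i j).le) hqsum hF0 (M := M)
    (fun m hm b => Ioo_subset_Icc_self (hcomp m hm b).1)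
    (fun m hm b => sqExpKernel_mem_Icc hr hξ₁ hθξ.1 hρ1 hρ9
      (by simpa [Metric.mem_ball, Real.dist_eq] using (hcomp m hm b).2.2) (hlt _))
    (fun m hm b => by
      have := atomBound_le hr hr1 hs₀ hs hΔsq.le huy (e b).2 (hcomp m hm b)
      rwa [← hA₀] at this)
    hS
    (by
      refine le_trans (pow_le_pow_left₀ (by linarith) ?_ M) hM.le
      gcongr)
  have hqF : ∀ i, 0 ≤ ∑ j, q i j * F i j := fun i =>
    Finset.sum_nonneg fun j _ => mul_nonneg (hqpos i j).le (hF0 i j)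
  constructor
  · refine le_trans (ENNReal.ofReal_le_ofReal ?_) hmodel
    -- Only the wide component is kept at each knot; the normalized kernel weights then sum to one.
    have hterm : ∀ i, w i / W * ((1 - r) / 2 * E) ≤ w i / W * ∑ j, q i j * F i j := fun i => by
      have : 0 ≤ w i / W := (div_pos (hwpos i) hWpos).le
      refine mul_le_mul_of_nonneg_left ?_ this
      exact Finset.single_le_sum (f := fun j => q i j * F i j)
        (fun j _ => mul_nonneg (hqpos i j).le (hF0 i j)) (Finset.mem_univ none)
    have hsum := Finset.sum_le_sum fun i (_ : i ∈ Finset.univ) => hterm i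
    rw [← Finset.sum_mul, ← Finset.sum_div, div_self hWpos.ne', one_mul] at hsum
    calc r ^ 6 * ((1 - r) / 2) * A₀ * Real.exp (-(1 / s₀ ^ 2) * y ^ 2)
        = r ^ 5 * ((1 - r) / 2 * E) := by rw [hE]; ring
      _ ≤ _ := by gcongr
  · intro hy
    set I : ℝ := (localInf Λ f₀ δ (y, l)).toReal with hI
    have hI0 : 0 ≤ I := ENNReal.toReal_nonneg
    have hIe : ENNReal.ofReal I = localInf Λ f₀ δ (y, l) :=
      ENNReal.ofReal_toReal ((localInf_le_self hδ hl).trans_lt ENNReal.ofReal_lt_top).ne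
    rw [← hIe, ← ENNReal.ofReal_mul (by positivity)]
    refine le_trans (ENNReal.ofReal_le_ofReal ?_) hmodel
    have hnear : ∀ i : T, |l - i| < δ₂ → r ^ 8 * I ≤ ∑ j, q i j * F i j := by
      intro i hi
      have hkey := mul_localInf_le_sum_cellMass (hg1 i) (u := u) (η := η) (N := N) hr hr1
        (by positivity : 0 < r * s ^ 2) hΔpos hΔsq.le hI0
        (hv₀g _ (by positivity) ((mul_le_of_le_one_left (by positivity) hr1.le).trans_lt
          ((mul_le_of_le_one_left (sq_nonneg s) hr1.le).trans_lt hsv₀)) u)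
        (fun z hz => by
          rw [hIe]
          refine localInf_le (hTΛ i) ?_ (hi.trans_le (min_le_right _ _))
          have h1 : |m₀ l - m₀ i| < η := by
            have := hm₀δ l hl i (hTΛ i) (by
              rw [Real.dist_eq]; exact hi.trans_le (min_le_left _ _))
            rwa [Real.dist_eq] at this
          have h2 : |u - z| < η := by
            rw [abs_lt]
            constructor <;> linarith [hz.1, hz.2]
          rw [abs_lt] at h1 h2 hum ⊢
          dsimp only
          constructor <;> linarith [h1.1, h1.2, h2.1, h2.2, hum.1, hum.2])
        (fun z hz => by
          have h1 := abs_le.1 huy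
          have h2 := abs_le.1 (hy.trans (le_abs_self R))
          refine Finset.mem_Icc.2 ⟨Int.floor_mono ?_, Int.floor_mono ?_⟩ <;>
            gcongr <;> linarith [hz.1, hz.2])
      rw [Fintype.sum_option]
      have hterm : ∀ j : N, r ^ 5 * (cellMass (g i) Δ j *
          gaussianPDFReal ((j : ℤ) * Δ) (r * s ^ 2).toNNReal u) ≤ q i (some j) * F i (some j) := by
        intro j
        have h3 : r * cellMass (g i) Δ j ≤ q i (some j) := by
          simp only [hq, stickShare]
          exact le_add_of_nonneg_right (by positivity)
        calc _ = (r * cellMass (g i) Δ j) * F i (some j) := by simp only [hF, atomBound]; ring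
          _ ≤ _ := mul_le_mul_of_nonneg_right h3 (hF0 i (some j))
      have hsum := Finset.sum_le_sum fun j (_ : j ∈ Finset.univ) => hterm j
      rw [← Finset.mul_sum] at hsum
      calc r ^ 8 * I = r ^ 5 * (r ^ 3 * I) := by ring
        _ ≤ _ := by gcongr
        _ ≤ _ := hsum
        _ ≤ _ := le_add_of_nonneg_left (mul_nonneg (hqpos i none).le (hF0 i none))
    have hloc := mul_sum_sqExpKernel_le (t := fun i : T => (i : ℝ)) hδ₂pos (hnet l hl)
      (hξ₀exp _ (hξ₁.trans hθξ.1) hθξ.2)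
    set T₁ : Finset T := Finset.univ.filter fun i : T => |l - (i : ℝ)| < δ₂
    -- `r ^ 5` from the stick breaking, `r` from discarding far knots, and `r ^ 8` from share (`r`),
    -- atom (`r ^ 4`) and convolution (`r ^ 3`).
    calc r ^ 14 * I = r ^ 5 * (r * (r ^ 8 * I)) := by ring
      _ ≤ r ^ 5 * ∑ i, w i / W * ∑ j, q i j * F i j := by
          refine mul_le_mul_of_nonneg_left ?_ (by positivity)
          calc r * (r ^ 8 * I) ≤ (∑ i ∈ T₁, w i) / W * (r ^ 8 * I) := by
                gcongr
                rw [le_div_iff₀ hWpos]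
                exact hloc
            _ = ∑ i ∈ T₁, w i / W * (r ^ 8 * I) := by
                rw [Finset.sum_div, Finset.sum_mul]
            _ ≤ ∑ i ∈ T₁, w i / W * ∑ j, q i j * F i j :=
                Finset.sum_le_sum fun i hi => mul_le_mul_of_nonneg_left
                  (hnear i (Finset.mem_filter.1 hi).2) (div_pos (hwpos i) hWpos).le
            _ ≤ _ := Finset.sum_le_sum_of_subset_of_nonneg (Finset.filter_subset _ _)
                fun i _ _ => mul_nonneg (div_pos (hwpos i) hWpos).le (hqF i)

/-! ### The local infimum of the density -/

/-- The strict inequality in the neighbourhoods makes the infimum upper semicontinuous, for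
arbitrary `f₀`. -/
theorem measurable_localInf (Λ : Set ℝ) (f₀ : ℝ → ℝ → ℝ) (δ : ℝ) :
    Measurable (localInf Λ f₀ δ) := by
  refine measurable_of_Iio fun c => IsOpen.measurableSet ?_
  have hset : localInf Λ f₀ δ ⁻¹' Iio c =
      ⋃ q ∈ {q : ℝ × ℝ | q.2 ∈ Λ ∧ ENNReal.ofReal (f₀ q.1 q.2) < c},
      {p : ℝ × ℝ | |p.1 - q.1| < δ ∧ |p.2 - q.2| < δ} := by
    ext p
    simp only [localInf, mem_preimage, mem_Iio, iInf_lt_iff, mem_iUnion, mem_ofPred_eq]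
    constructor
    · rintro ⟨q, ⟨h1, h2⟩, h3⟩
      exact ⟨q, ⟨h1, h3⟩, h2⟩
    · rintro ⟨q, ⟨h1, h3⟩, h2⟩
      exact ⟨q, ⟨h1, h2⟩, h3⟩
  rw [hset]
  refine isOpen_biUnion fun q _ => ?_
  exact (isOpen_lt (f := fun p : ℝ × ℝ => |p.1 - q.1|) (by fun_prop) continuous_const).inter
    (isOpen_lt (f := fun p : ℝ × ℝ => |p.2 - q.2|) (by fun_prop) continuous_const)

theorem localInf_anti (Λ : Set ℝ) (f₀ : ℝ → ℝ → ℝ) {δ δ' : ℝ} (h : δ ≤ δ') (p : ℝ × ℝ) :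
    localInf Λ f₀ δ' p ≤ localInf Λ f₀ δ p :=
  biInf_mono fun _ hq => ⟨hq.1, hq.2.1.trans_le h, hq.2.2.trans_le h⟩

/-- The density is at least the infimum on an interval of length `2 * δ` and has mass one. -/
theorem localInf_mul_le_one {Λ : Set ℝ} {f₀ : ℝ → ℝ → ℝ} {δ : ℝ} (hδ : 0 < δ) {p : ℝ × ℝ}
    (hp : p.2 ∈ Λ) (hf₀ : ∫⁻ y, ENNReal.ofReal (f₀ y p.2) = 1) :
    localInf Λ f₀ δ p * ENNReal.ofReal (2 * δ) ≤ 1 := by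
  rw [← hf₀]
  have hvol : volume (Ioo (p.1 - δ) (p.1 + δ)) = ENNReal.ofReal (2 * δ) := by
    rw [Real.volume_Ioo]
    congr 1
    ring
  rw [← hvol, ← setLIntegral_const]
  refine (setLIntegral_mono' measurableSet_Ioo fun s hs => ?_).trans (setLIntegral_le_lintegral _ _)
  refine localInf_le hp ?_ (by simpa using hδ)
  rw [abs_lt]
  constructor <;> linarith [hs.1, hs.2]

open Filter Topology in
theorem tendsto_localInf {Λ : Set ℝ} {f₀ : ℝ → ℝ → ℝ} {p : ℝ × ℝ} (hp : p.2 ∈ Λ)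
    (hc : ContinuousWithinAt (Function.uncurry f₀) (univ ×ˢ Λ) p) {δ : ℕ → ℝ}
    (hδ : ∀ n, 0 < δ n) (hδ0 : Tendsto δ atTop (𝓝 0)) :
    Tendsto (fun n => localInf Λ f₀ (δ n) p) atTop (𝓝 (ENNReal.ofReal (f₀ p.1 p.2))) := by
  refine tendsto_order.2 ⟨fun c hlt => ?_, fun c hlt => Eventually.of_forall fun n =>
    (localInf_le_self (hδ n) hp).trans_lt hlt⟩
  obtain ⟨c', hcc', hlt'⟩ := exists_between hlt
  have hc' : Tendsto (fun q : ℝ × ℝ => ENNReal.ofReal (f₀ q.1 q.2)) (𝓝[univ ×ˢ Λ] p)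
      (𝓝 (ENNReal.ofReal (f₀ p.1 p.2))) :=
    (ENNReal.continuous_ofReal.tendsto _).comp hc
  have hev := hc'.eventually (lt_mem_nhds hlt')
  obtain ⟨ε, hε, hball⟩ := Metric.mem_nhdsWithin_iff.1 hev
  filter_upwards [(tendsto_order.1 hδ0).2 ε hε] with n hn
  refine hcc'.trans_le (le_iInf₂ fun q hq => le_of_lt (hball ⟨?_, mem_univ _, hq.1⟩))
  rw [Metric.mem_ball, dist_comm, Prod.dist_eq, max_lt_iff, Real.dist_eq, Real.dist_eq]
  exact ⟨hq.2.1.trans hn, hq.2.2.trans hn⟩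

/-! ### Consequences of the conditional density -/

namespace LogPeriodogram.IsCondDensity

variable {Λ : Set ℝ} {F₀ : Measure (ℝ × ℝ)} {f₀ : ℝ → ℝ → ℝ}

theorem measurable_ofReal (h : IsCondDensity Λ F₀ f₀) :
    Measurable fun p : ℝ × ℝ => ENNReal.ofReal (f₀ p.1 p.2) := h.measurable.ennreal_ofReal

theorem ae_mem (h : IsCondDensity Λ F₀ f₀) : ∀ᵐ p ∂F₀, p.2 ∈ Λ := by
  have h1 : ∀ᵐ l ∂F₀.snd, l ∈ Λ := h.marginal
  exact ae_of_ae_map measurable_snd.aemeasurable h1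

theorem ae_pos (h : IsCondDensity Λ F₀ f₀) : ∀ᵐ p ∂F₀, 0 < f₀ p.1 p.2 := by
  have := (ae_withDensity_iff (μ := volume.prod F₀.snd) (p := fun p : ℝ × ℝ => 0 < f₀ p.1 p.2)
    h.measurable_ofReal).2 (Filter.Eventually.of_forall fun p hp =>
      ENNReal.ofReal_pos.1 (pos_iff_ne_zero.2 hp))
  rwa [← h.law_eq] at this

theorem absolutelyContinuous (h : IsCondDensity Λ F₀ f₀) : F₀ ≪ volume.prod F₀.snd := by
  have := withDensity_absolutelyContinuous (volume.prod F₀.snd)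
    (fun p : ℝ × ℝ => ENNReal.ofReal (f₀ p.1 p.2))
  rwa [← h.law_eq] at this

theorem lintegral_div_le (h : IsCondDensity Λ F₀ f₀) {f : ℝ × ℝ → ℝ≥0∞} (hf : Measurable f) :
    ∫⁻ p, f p / ENNReal.ofReal (f₀ p.1 p.2) ∂F₀ ≤ ∫⁻ p, f p ∂(volume.prod F₀.snd) := by
  have e := lintegral_withDensity_eq_lintegral_mul (volume.prod F₀.snd) h.measurable_ofReal
    (hf.div h.measurable_ofReal)
  rw [← h.law_eq] at e
  rw [show (fun p : ℝ × ℝ => f p / ENNReal.ofReal (f₀ p.1 p.2))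
    = f / fun p : ℝ × ℝ => ENNReal.ofReal (f₀ p.1 p.2) from rfl, e]
  exact lintegral_mono fun p => ENNReal.mul_div_le

end LogPeriodogram.IsCondDensity

/-! ### From pointwise bounds to the Kullback–Leibler divergence -/

theorem condKL_modelDensity_le {Λ : Set ℝ} {F₀ : Measure (ℝ × ℝ)} [IsProbabilityMeasure F₀]
    {f₀ : ℝ → ℝ → ℝ} (hf₀ : IsCondDensity Λ F₀ f₀) {θ : Param}
    (hθ : AdmissibleComponents θ.2.2.2) {g : ℝ × ℝ → ℝ} (hg : Integrable g F₀)
    (hpos : ∀ᵐ p ∂F₀, modelDensity θ p.1 p.2 ≠ 0)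
    (hle : ∀ᵐ p ∂F₀, modelDensity θ p.1 p.2 ≠ ⊤ →
      Real.log (f₀ p.1 p.2 / (modelDensity θ p.1 p.2).toReal) ≤ g p) :
    condKL F₀ f₀ (modelDensity θ) ≤ ((∫ p, g p ∂F₀ : ℝ) : EReal) := by
  have hm := measurable_modelDensity θ
  have hmass : ∫⁻ p, modelDensity θ p.1 p.2 ∂(volume.prod F₀.snd) ≤ 1 := by
    rw [lintegral_prod_symm _ hm.aemeasurable]
    refine (lintegral_mono fun l => lintegral_modelDensity_le_one hθ l).trans ?_
    simp
  have htop : ∀ᵐ p ∂F₀, modelDensity θ p.1 p.2 ≠ ⊤ :=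
    hf₀.absolutelyContinuous ((ae_lt_top hm (hmass.trans_lt ENNReal.one_lt_top).ne).mono
      fun p hp => hp.ne)
  have hψ : Integrable (fun p : ℝ × ℝ =>
      (modelDensity θ p.1 p.2 / ENNReal.ofReal (f₀ p.1 p.2)).toReal) F₀ :=
    integrable_toReal_of_lintegral_ne_top (hm.div hf₀.measurable_ofReal).aemeasurable
      (((hf₀.lintegral_div_le hm).trans hmass).trans_lt ENNReal.one_lt_top).ne
  have hφm : Measurable fun p : ℝ × ℝ =>
      Real.log (f₀ p.1 p.2 / (modelDensity θ p.1 p.2).toReal) :=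
    Real.measurable_log.comp (hf₀.measurable.div hm.ennreal_toReal)
  have hle' : ∀ᵐ p ∂F₀, Real.log (f₀ p.1 p.2 / (modelDensity θ p.1 p.2).toReal) ≤ g p := by
    filter_upwards [htop, hle] with p h1 h2 using h2 h1
  have hφ : Integrable (fun p : ℝ × ℝ =>
      Real.log (f₀ p.1 p.2 / (modelDensity θ p.1 p.2).toReal)) F₀ := by
    refine Integrable.mono' (hg.abs.add hψ) hφm.aestronglyMeasurable ?_
    filter_upwards [hpos, htop, hle', hf₀.ae_pos] with p h0 h1 h2 h3
    -- The negative part is handled by `log x ≤ x - 1` at `x = f / f₀`, whose `F₀`-integral is at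
    -- most the total mass of `f`.
    have hf : 0 < (modelDensity θ p.1 p.2).toReal := ENNReal.toReal_pos h0 h1
    have hlower : -Real.log (f₀ p.1 p.2 / (modelDensity θ p.1 p.2).toReal) ≤
        (modelDensity θ p.1 p.2 / ENNReal.ofReal (f₀ p.1 p.2)).toReal := by
      rw [← Real.log_inv, inv_div, ENNReal.toReal_div, ENNReal.toReal_ofReal h3.le]
      exact (Real.log_le_sub_one_of_pos (by positivity)).trans (by linarith)
    have h4 : (0 : ℝ) ≤ (modelDensity θ p.1 p.2 / ENNReal.ofReal (f₀ p.1 p.2)).toReal :=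
      ENNReal.toReal_nonneg
    simp only [Pi.add_apply]
    rw [Real.norm_eq_abs, abs_le]
    constructor
    · linarith [abs_nonneg (g p)]
    · linarith [le_abs_self (g p)]
  rw [condKL, if_pos ⟨by filter_upwards [hpos, htop] with p h0 h1 using ⟨h0, h1⟩, hφ⟩]
  exact EReal.coe_le_coe_iff.2 (integral_mono_ae hφ hg hle')

theorem integrable_sq_of_integrable_log {F₀ : Measure (ℝ × ℝ)} [IsProbabilityMeasure F₀]
    (hlog : Integrable (fun p : ℝ × ℝ =>
      Real.log (gaussianPDFReal 0 (Real.toNNReal (1 ^ 2)) p.1)) F₀) :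
    Integrable (fun p : ℝ × ℝ => p.1 ^ 2) F₀ := by
  have e : (fun p : ℝ × ℝ => p.1 ^ 2) = fun p : ℝ × ℝ => (-2) *
      (Real.log (gaussianPDFReal 0 (Real.toNNReal (1 ^ 2)) p.1)
        - Real.log (√(2 * Real.pi * 1 ^ 2))⁻¹) := by
    funext p
    rw [gaussianPDFReal_toNNReal (by positivity), Real.log_mul (by positivity)
      (Real.exp_pos _).ne', Real.log_exp]
    ring
  rw [e]
  exact (hlog.sub (integrable_const _)).const_mul _

/-- Finiteness excludes a zero infimum, and the ratio is at least one, so truncating the logarithm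
at zero changes nothing. -/
theorem log_localInf_ratio {Λ : Set ℝ} {f₀ : ℝ → ℝ → ℝ} {δ : ℝ} (hδ : 0 < δ) {p : ℝ × ℝ}
    (hp : p.2 ∈ Λ) (hpos : 0 < f₀ p.1 p.2)
    (hfin : (ENNReal.log (ENNReal.ofReal (f₀ p.1 p.2) / localInf Λ f₀ δ p)).toENNReal < ⊤) :
    0 < (localInf Λ f₀ δ p).toReal ∧
      (ENNReal.log (ENNReal.ofReal (f₀ p.1 p.2) / localInf Λ f₀ δ p)).toENNReal.toReal
        = Real.log (f₀ p.1 p.2) - Real.log (localInf Λ f₀ δ p).toReal := by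
  have hle := localInf_le_self (f₀ := f₀) hδ hp
  have hItop : localInf Λ f₀ δ p ≠ ⊤ := (hle.trans_lt ENNReal.ofReal_lt_top).ne
  have hf0 : ENNReal.ofReal (f₀ p.1 p.2) ≠ 0 := (ENNReal.ofReal_pos.2 hpos).ne'
  have hI0 : localInf Λ f₀ δ p ≠ 0 := by
    intro h0
    rw [h0, ENNReal.div_zero hf0, ENNReal.log_top, EReal.toENNReal_top] at hfin
    exact hfin.ne rfl
  have hI : 0 < (localInf Λ f₀ δ p).toReal := ENNReal.toReal_pos hI0 hItop
  refine ⟨hI, ?_⟩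
  have hr0 : 0 < (ENNReal.ofReal (f₀ p.1 p.2) / localInf Λ f₀ δ p).toReal := by
    rw [ENNReal.toReal_div, ENNReal.toReal_ofReal hpos.le]
    positivity
  have hIle : (localInf Λ f₀ δ p).toReal ≤ f₀ p.1 p.2 := ENNReal.toReal_le_of_le_ofReal hpos.le hle
  rw [ENNReal.log_pos_real' hr0, EReal.toENNReal_of_ne_top (EReal.coe_ne_top _), EReal.toReal_coe,
    ENNReal.toReal_div, ENNReal.toReal_ofReal hpos.le, Real.log_div hpos.ne' hI.ne',
    ENNReal.toReal_ofReal (sub_nonneg.2 (Real.log_le_log hI hIle))]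

theorem log_le_of_localInf_pos {Λ : Set ℝ} {f₀ : ℝ → ℝ → ℝ} {δ : ℝ} (hδ : 0 < δ) {p : ℝ × ℝ}
    (hp : p.2 ∈ Λ) (hf₀ : ∫⁻ y, ENNReal.ofReal (f₀ y p.2) = 1)
    (hI : 0 < (localInf Λ f₀ δ p).toReal) :
    Real.log (localInf Λ f₀ δ p).toReal ≤ -Real.log (2 * δ) := by
  have h := ENNReal.toReal_mono ENNReal.one_ne_top (localInf_mul_le_one hδ hp hf₀)
  rw [ENNReal.toReal_mul, ENNReal.toReal_ofReal (by positivity), ENNReal.toReal_one] at h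
  have h2 := Real.log_nonpos (by positivity) h
  rw [Real.log_mul hI.ne' (by positivity)] at h2
  linarith

open Filter Topology in
/-- Domination: lower bounds of the form provided by the prior control the integrated
log-ratio. -/
theorem exists_dominating_sequence {Λ : Set ℝ} {F₀ : Measure (ℝ × ℝ)} [IsProbabilityMeasure F₀]
    {f₀ : ℝ → ℝ → ℝ} (hf₀ : IsCondDensity Λ F₀ f₀)
    (hcont : ∀ᵐ p ∂F₀, ContinuousWithinAt (Function.uncurry f₀) (Set.univ ×ˢ Λ) p)
    (hsq : Integrable (fun p : ℝ × ℝ => p.1 ^ 2) F₀) {δ : ℝ} (hδ : 0 < δ)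
    (hinf : ∫⁻ p, (ENNReal.log (ENNReal.ofReal (f₀ p.1 p.2) /
      localInf Λ f₀ δ p)).toENNReal ∂F₀ < ⊤)
    {A k τ : ℝ} (hA : 0 < A) (hk : 0 < k) (hτ : 0 < τ) {ε : ℝ} (hε : -Real.log τ < ε) :
    ∃ δ' R : ℝ, 0 < δ' ∧ ∃ g : ℝ × ℝ → ℝ, Integrable g F₀ ∧ ∫ p, g p ∂F₀ < ε ∧
      ∀ f : ℝ × ℝ → ℝ≥0∞, (∀ p : ℝ × ℝ, p.2 ∈ Λ →
        ENNReal.ofReal (A * Real.exp (-k * p.1 ^ 2)) ≤ f p ∧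
        (|p.1| ≤ R → ENNReal.ofReal τ * localInf Λ f₀ δ' p ≤ f p)) →
      ∀ᵐ p ∂F₀, f p ≠ ⊤ → Real.log (f₀ p.1 p.2 / (f p).toReal) ≤ g p := by
  set D : ℝ × ℝ → ℝ≥0∞ := fun p =>
    (ENNReal.log (ENNReal.ofReal (f₀ p.1 p.2) / localInf Λ f₀ δ p)).toENNReal with hD
  have hDm : Measurable D := EReal.continuous_toENNReal.measurable.comp
    (ENNReal.continuous_log.measurable.comp
      (hf₀.measurable_ofReal.div (measurable_localInf Λ f₀ δ)))
  have hDint : Integrable (fun p => (D p).toReal) F₀ :=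
    integrable_toReal_of_lintegral_ne_top hDm.aemeasurable hinf.ne
  set δs : ℕ → ℝ := fun n => min δ (1 / ((n : ℝ) + 1)) with hδs
  have hδspos : ∀ n, 0 < δs n := fun n => lt_min hδ (by positivity)
  have hδs0 : Tendsto δs atTop (𝓝 0) :=
    squeeze_zero (fun n => (hδspos n).le) (fun n => min_le_right _ _)
      tendsto_one_div_add_atTop_nhds_zero_nat
  set J : ℕ → ℝ × ℝ → ℝ := fun n p => (localInf Λ f₀ (δs n) p).toReal with hJ
  -- Outside `[-n, n]` the Gaussian bound is used, with `log f₀ ≤ D - log (2 * δ)`. Since `δs n ≤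
  -- δ`, `D` also dominates the log-ratio inside.
  set g : ℕ → ℝ × ℝ → ℝ := fun n p => if |p.1| ≤ n
    then -Real.log τ + (Real.log (f₀ p.1 p.2) - Real.log (J n p))
    else (D p).toReal - Real.log (2 * δ) - Real.log A + k * p.1 ^ 2 with hg
  have hgm : ∀ n, Measurable (g n) := fun n => by
    have h1 : Measurable fun p : ℝ × ℝ => Real.log (f₀ p.1 p.2) :=
      Real.measurable_log.comp hf₀.measurable
    have h2 : Measurable fun p : ℝ × ℝ => Real.log (J n p) :=
      Real.measurable_log.comp (measurable_localInf Λ f₀ (δs n)).ennreal_toReal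
    refine Measurable.ite (measurableSet_le (f := fun p : ℝ × ℝ => |p.1|) (by fun_prop)
      measurable_const) ((h1.sub h2).const_add _) ?_
    have h3 := hDm.ennreal_toReal
    fun_prop
  have hfacts : ∀ᵐ p ∂F₀, ∀ n, 0 < f₀ p.1 p.2 ∧ 0 < J n p ∧
      Real.log (f₀ p.1 p.2) - Real.log (J n p) ∈ Icc 0 (D p).toReal ∧
      Real.log (f₀ p.1 p.2) ≤ (D p).toReal - Real.log (2 * δ) := by
    filter_upwards [hf₀.ae_mem, hf₀.ae_pos, ae_lt_top hDm hinf.ne] with p hp hpos hfin n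
    obtain ⟨hI, hDI⟩ := log_localInf_ratio hδ hp hpos hfin
    have hle := localInf_le_self (f₀ := f₀) (hδspos n) hp
    have hJle : J n p ≤ f₀ p.1 p.2 := ENNReal.toReal_le_of_le_ofReal hpos.le hle
    have hIJ : (localInf Λ f₀ δ p).toReal ≤ J n p := ENNReal.toReal_mono
      (hle.trans_lt ENNReal.ofReal_lt_top).ne (localInf_anti Λ f₀ (min_le_left _ _) p)
    have hJpos : 0 < J n p := hI.trans_le hIJ
    have h1 := Real.log_le_log hI hIJ
    have h2 := Real.log_le_log hJpos hJle
    have h3 := log_le_of_localInf_pos hδ hp (hf₀.lintegral_eq_one _ hp) hI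
    have hDI' : (D p).toReal = _ := hDI
    exact ⟨hpos, hJpos, ⟨by linarith, by linarith⟩, by linarith⟩
  set bound : ℝ × ℝ → ℝ := fun p =>
    (D p).toReal + (|Real.log τ| + |Real.log (2 * δ)| + |Real.log A|) + k * p.1 ^ 2 with hbound
  have hboundint : Integrable bound F₀ :=
    (hDint.add (integrable_const _)).add (hsq.const_mul k)
  have hgbound : ∀ n, ∀ᵐ p ∂F₀, ‖g n p‖ ≤ bound p := fun n => by
    filter_upwards [hfacts] with p hp
    obtain ⟨-, -, ⟨h1, h2⟩, h3⟩ := hp n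
    have h4 : 0 ≤ k * p.1 ^ 2 := by positivity
    have h5 : 0 ≤ (D p).toReal := ENNReal.toReal_nonneg
    have a1 := abs_le.1 (le_refl |Real.log τ|)
    have a2 := abs_le.1 (le_refl |Real.log (2 * δ)|)
    have a3 := abs_le.1 (le_refl |Real.log A|)
    simp only [hg, hbound, Real.norm_eq_abs]
    rw [abs_le]
    split_ifs <;> constructor <;> linarith [a1.1, a1.2, a2.1, a2.2, a3.1, a3.2]
  have hgint : ∀ n, Integrable (g n) F₀ := fun n =>
    Integrable.mono' hboundint (hgm n).aestronglyMeasurable (hgbound n)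
  have hlim : ∀ᵐ p ∂F₀, Tendsto (fun n => g n p) atTop (𝓝 (-Real.log τ)) := by
    filter_upwards [hfacts, hcont, hf₀.ae_mem] with p hp hc hpΛ
    have hpos := (hp 0).1
    have hJlim : Tendsto (fun n => J n p) atTop (𝓝 (f₀ p.1 p.2)) := by
      have := (ENNReal.tendsto_toReal ENNReal.ofReal_ne_top).comp
        (tendsto_localInf hpΛ hc hδspos hδs0)
      rwa [ENNReal.toReal_ofReal hpos.le] at this
    have hloglim := (Real.continuousAt_log hpos.ne').tendsto.comp hJlim
    have hsum := (hloglim.const_sub (Real.log (f₀ p.1 p.2))).const_add (-Real.log τ)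
    rw [sub_self, add_zero] at hsum
    refine hsum.congr' ?_
    filter_upwards [eventually_ge_atTop ⌈|p.1|⌉₊] with n hn
    simp only [hg, if_pos (Nat.ceil_le.1 hn), Function.comp]
  have htend := tendsto_integral_of_dominated_convergence bound
    (fun n => (hgm n).aestronglyMeasurable) hboundint hgbound hlim
  rw [integral_const, probReal_univ, one_smul] at htend
  obtain ⟨n, hn⟩ := ((tendsto_order.1 htend).2 ε hε).exists
  refine ⟨δs n, n, hδspos n, g n, hgint n, hn, fun f hf => ?_⟩
  filter_upwards [hfacts, hf₀.ae_mem] with p hp hpΛ htop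
  obtain ⟨hpos, hJpos, -, hlog⟩ := hp n
  obtain ⟨hf1, hf2⟩ := hf p hpΛ
  have hlower1 : A * Real.exp (-k * p.1 ^ 2) ≤ (f p).toReal :=
    (ENNReal.ofReal_le_iff_le_toReal htop).1 hf1
  have hexp : 0 < A * Real.exp (-k * p.1 ^ 2) := by positivity
  have hfpos : 0 < (f p).toReal := hexp.trans_le hlower1
  rw [Real.log_div hpos.ne' hfpos.ne']
  simp only [hg]
  split_ifs with hy
  · have h1 := ENNReal.toReal_mono htop (hf2 hy)
    rw [ENNReal.toReal_mul, ENNReal.toReal_ofReal hτ.le] at h1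
    have h2 := Real.log_le_log (mul_pos hτ hJpos) h1
    rw [Real.log_mul hτ.ne' hJpos.ne'] at h2
    linarith
  · have h2 := Real.log_le_log hexp hlower1
    rw [Real.log_mul hA.ne' (Real.exp_pos _).ne', Real.log_exp] at h2
    linarith

theorem theorem1
    -- frequencies: a compact subset of `(0, π]`, e.g. the Fourier frequencies or an interval
    (Λ : Set ℝ) (hΛc : IsCompact Λ) (hΛ : Λ ⊆ Set.Ioc 0 Real.pi)
    -- the true law of `(y, λ)` and its conditional densities
    (F₀ : Measure (ℝ × ℝ)) [IsProbabilityMeasure F₀] (f₀ : ℝ → ℝ → ℝ)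
    (hf₀ : IsCondDensity Λ F₀ f₀) (c₀ d₀ : ℝ)
    -- `E[y | λ] = c₀ - d₀ log λ` almost surely
    (hmean : ∀ᵐ l ∂F₀.snd, ∫ y, y * f₀ y l = c₀ - d₀ * Real.log l)
    -- `f₀(y | λ)` is continuous in `(y, λ)` almost surely
    (hcont : ∀ᵐ p ∂F₀, ContinuousWithinAt (Function.uncurry f₀) (Set.univ ×ˢ Λ) p)
    -- the log of the Gaussian location-scale density is `F₀`-integrable
    (hlog : ∀ μ σ : ℝ, 0 < σ →
      Integrable (fun p : ℝ × ℝ => Real.log (gaussianPDFReal μ (Real.toNNReal (σ ^ 2)) p.1)) F₀)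
    -- `E[y² | λ] < ∞` for all `λ`
    (hsq : ∀ l ∈ Λ, Integrable fun y => y ^ 2 * f₀ y l)
    -- integrability of the log-ratio of `f₀` to its local infimum
    (hinf : ∃ δ : ℝ, 0 < δ ∧
      ∫⁻ p, (ENNReal.log (ENNReal.ofReal (f₀ p.1 p.2) / localInf Λ f₀ δ p)).toENNReal ∂F₀ < ⊤)
    -- the priors of `c` and `d`
    (Pc Pd : Measure ℝ) [IsProbabilityMeasure Pc] [IsProbabilityMeasure Pd]
    (hc₀ : c₀ ∈ interior Pc.support) (hd₀ : d₀ ∈ interior Pd.support)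
    -- the prior of the bandwidth
    (Ξ : Measure ℝ) [IsProbabilityMeasure Ξ] (hΞ : ∀ᵐ ξ ∂Ξ, 0 < ξ)
    (hΞ0 : ∀ δ : ℝ, 0 < δ → 0 < Ξ (Set.Iio δ))
    -- the parameters of the beta stick variables
    (a b : ℕ → ℝ) (ha : ∀ h, 0 < a h) (hb : ∀ h, 0 < b h)
    -- the law of the knots
    (Ψ : Measure ℝ) [IsProbabilityMeasure Ψ] (hΨ : Ψ.support = Λ)
    -- the law of the atoms `(π, μ, σ₁, σ₂)`: given the scales, `(π, μ)` has full support
    (G : Measure Atom) [IsProbabilityMeasure G]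
    (hG : ∀ᵐ t ∂G, t.1 ∈ Set.Ioo (0 : ℝ) 1 ∧ 0 < t.2.2.1 ∧ 0 < t.2.2.2)
    (hGfull : ∀ U : Set (ℝ × ℝ), IsOpen U → U.Nonempty → U ⊆ Set.Ioo (0 : ℝ) 1 ×ˢ Set.univ →
      ∀ S : Set (ℝ × ℝ), MeasurableSet S → 0 < G {t | t.2.2 ∈ S} →
        0 < G {t | (t.1, t.2.1) ∈ U ∧ t.2.2 ∈ S})
    -- arbitrarily small values of `σ₁` are charged
    (hGσ : ∀ δ : ℝ, 0 < δ → 0 < G {t | t.2.2.1 < δ}) :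
    ∀ ε : ℝ, 0 < ε →
      0 < prior Pc Pd Ξ a b G Ψ {θ | condKL F₀ f₀ (modelDensity θ) < (ε : EReal)} := by
  intro ε hε
  obtain ⟨δ, hδ, hinfδ⟩ := hinf
  -- Chosen so that `-log (r ^ 14) = ε / 2`.
  set r : ℝ := Real.exp (-(ε / 28)) with hr
  have hr0 : 0 < r := Real.exp_pos _
  have hr1 : r < 1 := Real.exp_lt_one_iff.mpr (by linarith)
  have hlogr : -Real.log (r ^ 14) < ε := by
    rw [Real.log_pow, hr, Real.log_exp]
    push_cast
    linarith
  obtain ⟨A, k, hA, hk, hprior⟩ := prior_lowerBound_pos hΛc hΛ hf₀.lintegral_eq_one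
    (interior_subset hc₀) (interior_subset hd₀) hΞ hΞ0 ha hb hΨ hG hGfull hGσ hr0 hr1
  obtain ⟨δ', R, hδ', g, hg, hgε, hdom⟩ := exists_dominating_sequence hf₀ hcont
    (integrable_sq_of_integrable_log (hlog 0 1 one_pos)) hδ hinfδ hA hk (pow_pos hr0 14) hlogr
  refine (hprior δ' hδ' R).trans_le (measure_mono ?_)
  rintro θ ⟨hadm, hθ⟩
  have hθ' : ∀ p : ℝ × ℝ, p.2 ∈ Λ →
      ENNReal.ofReal (A * Real.exp (-k * p.1 ^ 2)) ≤ modelDensity θ p.1 p.2 ∧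
      (|p.1| ≤ R → ENNReal.ofReal (r ^ 14) * localInf Λ f₀ δ' p ≤ modelDensity θ p.1 p.2) :=
    fun p hp => hθ p.2 hp p.1
  refine (condKL_modelDensity_le hf₀ hadm hg ?_
    (hdom (fun p => modelDensity θ p.1 p.2) hθ')).trans_lt (EReal.coe_lt_coe_iff.2 hgε)
  filter_upwards [hf₀.ae_mem] with p hp
  exact ((ENNReal.ofReal_pos.2 (by positivity)).trans_le (hθ' p hp).1).ne'
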